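/- Let $d\ge 2$ and $k\ge 1$ be integers and let $1\le p,q\le\infty$ (with $1/\infty=0$). Let $\psi\in C_0^\infty([-2,-\tfrac12]\cup[\tfrac12,2])$ be a nonnegative even function with $\sum_{j\in\mathbb Z}\psi(2^{-j}t)=1$ for all $t\ne0$, put $\psi_0(t)=1-\sum_{j\ge1}\psi(2^{-j}t)$, and fix $0<\varepsilon_\circ\le 2^{-5}$. For $\varepsilon>0$ and $(\eta,\tau)\in\mathbb R^{d-1}\times\mathbb R=\mathbb R^d$ define $$m_\varepsilon(\eta,\tau)=\frac{\psi_0\big(\varepsilon_\circ^{-1}(1-|\eta|^2)\big)\,\psi(\varepsilon^{-1}\tau)}{(|\eta|^2-1+\tau^2+2i\tau)^k},$$ let $m_\varepsilon(D)f=\mathcal F^{-1}(m_\varepsilon\mathcal F f)$, where $\mathcal Ff(\xi)=\int_{\mathbb R^d}e^{-ix\cdot\xi}f(x)\,dx$ and $\mathcal F^{-1}g(x)=(2\pi)^{-d}\int_{\mathbb R^d}e^{ix\cdot\xi}g(\xi)\,d\xi$, and let $$\|m_\varepsilon(D)\|_{p\to q}=\sup\{\|m_\varepsilon(D)f\|_{L^q(\mathbb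 R^d)}: f\in\mathcal S(\mathbb R^d),\ \|f\|_{L^p(\mathbb R^d)}=1\}\in[0,\infty].$$ Then there are constants $c,\delta>0$, independent of $\varepsilon$, such that for all $0<\varepsilon\le\delta$ $$\|m_\varepsilon(D)\|_{p\to q}\ \ge\ c\,\varepsilon^{\frac dp-\frac1q-\frac{d-2+2k}2}.$$ Moreover, the exponent on the right is sharp for upper bounds: if $s,C\in\mathbb R$ are such that $\|m_\varepsilon(D)\|_{p\to q}\le C\varepsilon^{s}$ for all $\varepsilon\in\{2^\nu:\nu\in\mathbb Z,\ 2^\nu\le\varepsilon_\circ\}$, then $s\le\frac dp-\frac1q-\frac{d-2+2k}2$. -/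

import Mathlib

open MeasureTheory
open scoped ENNReal SchwartzMap ContDiff

/-- `ℝ^d` written as `ℝ^(d-1) × ℝ`, with points `(y, t)` or frequencies `(η, τ)`. It is used only for
`1 ≤ d`. The measure `volume` is Lebesgue measure on `ℝ^d`; the norm of the product is only
equivalent to the Euclidean one, which does not affect the class of Schwartz functions. -/
abbrev EucProd (d : ℕ) : Type := EuclideanSpace ℝ (Fin (d - 1)) × ℝ

/-- The Euclidean inner product `x · ξ` on `ℝ^d = ℝ^(d-1) × ℝ`. -/
noncomputable def eucDot {d : ℕ} (x ξ : EucProd d) : ℝ := inner ℝ x.1 ξ.1 + x.2 * ξ.2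

/-- The Fourier transform `∫ e^{-i x·ξ} f(x) dx`. -/
noncomputable def fourierT {d : ℕ} (f : EucProd d → ℂ) (ξ : EucProd d) : ℂ :=
  ∫ x : EucProd d, Complex.exp (-(Complex.I * (eucDot x ξ : ℂ))) * f x

/-- The inverse Fourier transform `(2π)^{-d} ∫ e^{i x·ξ} g(ξ) dξ`. -/
noncomputable def invFourierT {d : ℕ} (g : EucProd d → ℂ) (x : EucProd d) : ℂ :=
  (((2 * Real.pi) ^ d : ℝ) : ℂ)⁻¹ *
    ∫ ξ : EucProd d, Complex.exp (Complex.I * (eucDot x ξ : ℂ)) * g ξ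

/-- The Fourier multiplier operator `m(D)` on the Schwartz class. -/
noncomputable def multiplierOp {d : ℕ} (m : EucProd d → ℂ) (f : 𝓢(EucProd d, ℂ)) :
    EucProd d → ℂ :=
  invFourierT (fun ξ => m ξ * fourierT (fun x => f x) ξ)

/-- `‖T‖_{p→q} = sup {‖T f‖_q : f Schwartz, ‖f‖_p = 1}`, with values in `[0, ∞]`. -/
noncomputable def pqNorm {d : ℕ} (T : 𝓢(EucProd d, ℂ) → EucProd d → ℂ) (p q : ℝ≥0∞) : ℝ≥0∞ :=
  ⨆ (f : 𝓢(EucProd d, ℂ)) (_ : eLpNorm (fun x => f x) p volume = 1), eLpNorm (T f) q volume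

/-- `ψ ∈ C_0^∞([-2,-1/2] ∪ [1/2,2])` is nonnegative and even, and its dyadic dilates sum to `1`
away from the origin. -/
structure IsDyadicPartition (ψ : ℝ → ℝ) : Prop where
  smooth : ContDiff ℝ ∞ ψ
  supp : tsupport ψ ⊆ Set.Icc (-2) (-1 / 2) ∪ Set.Icc (1 / 2) 2
  nonneg : ∀ t, 0 ≤ ψ t
  even : ∀ t, ψ (-t) = ψ t
  sum_eq_one : ∀ t : ℝ, t ≠ 0 → HasSum (fun j : ℤ => ψ ((2 : ℝ) ^ (-j) * t)) 1

/-- `ψ₀(t) = 1 - ∑_{j ≥ 1} ψ(2^{-j} t)`; at each `t` only finitely many terms are nonzero. -/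
noncomputable def lowPart (ψ : ℝ → ℝ) (t : ℝ) : ℝ :=
  1 - ∑' j : ℕ, ψ ((2 : ℝ) ^ (-((j : ℤ) + 1)) * t)

/-- The multiplier
`m_ε(η, τ) = ψ₀(ε₀⁻¹ (1 - |η|²)) ψ(ε⁻¹ τ) / (|η|² - 1 + τ² + 2iτ)^k`.
The denominator vanishes only at points with `τ = 0`, where the numerator vanishes if
`ψ 0 = 0`. -/
noncomputable def mEps (d k : ℕ) (ψ : ℝ → ℝ) (ε₀ ε : ℝ) (ξ : EucProd d) : ℂ :=
  ((lowPart ψ (ε₀⁻¹ * (1 - ‖ξ.1‖ ^ 2)) * ψ (ε⁻¹ * ξ.2) : ℝ) : ℂ) /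
    (((‖ξ.1‖ ^ 2 - 1 + ξ.2 ^ 2 : ℝ) : ℂ) + 2 * Complex.I * (ξ.2 : ℂ)) ^ k

/-- The exponent `d/p - 1/q - (d - 2 + 2k)/2`, where `1/∞ = 0`. -/
noncomputable def lowerExponent (d k : ℕ) (p q : ℝ≥0∞) : ℝ :=
  (d : ℝ) * (p⁻¹).toReal - (q⁻¹).toReal - ((d : ℝ) - 2 + 2 * (k : ℝ)) / 2

/-! The operator is tested on one explicit function, a wave focusing at `y = 0`: `f(y, t) = exp (-(ε
+ i)|y|) exp (-(ε t)² / 2)`. Its transform in `y` is the Poisson kernel continued to `s = ε + i`, a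
constant times `s (s² + |η|²)^(-d/2)` (`exists_integral_exp_neg_mul_norm`), and `s² + |η|² = |η|² -
1 + ε² + 2iε` is the base of the denominator of `m_ε` at `τ = ε`. In `t` the transform is a Gaussian
of width `ε`. With `|η| = 1 + ε r`, `τ = ε u` and `γ = (d - 2 + 2k)/2`, the integral of `m_ε f̂`
becomes `ε^(-γ)`, up to factors bounded above and below, times an integral that converges by
domination (`tendsto_integral_scaledIntegrand`) to `∫∫ ψ(u) exp (-u²/2) (2r + 2i)^(-d/2) (2r +
2iu)^(-k) dr du`.

The crux is that this limit is not zero (`integral_limitIntegrand_ne_zero`). By Parseval the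
integral in `r` is a pairing of two Gamma densities (`integral_fourier_gammaKernel`). For `u > 0`
they live on opposite half-lines and it vanishes; for `u < 0` they share a half-line and it equals
`κ (1 - u)^(-(d/2 + k - 1))` with one fixed complex `κ ≠ 0`. Hence nothing cancels in `u`, and the
even function `ψ` does not vanish identically on `u < 0`.

So `|m_ε(D) f|` is at least of order `ε^(-γ)` at the origin. The frequencies involved have `|η| ≤ 2`
and `|τ| ≤ 2ε`, so the phase hardly moves on `|y| ≤ κ`, `|t| ≤ κ/ε` (a new small `κ`), a set of
measure of order `1/ε`, and the lower bound persists there (`exists_schwartz_amplified`). Since `|f|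
≤ 1` and `∫ |f|` is `O(ε^(-d))`, the `L^p` norm of `f` is `O(ε^(-d/p))`. The quotient of the norms
is of order at least `ε^(d/p - 1/q - γ)`. The wave is not smooth at `y = 0`, but Schwartz functions
dominated by it and close to it in `L¹` serve as well. Sharpness follows by letting dyadic `ε` tend
to zero. -/

namespace DyadicMultiplier

open Filter Topology Set

/-! ### Laplace transforms on the right half-plane and the Gamma integral -/

/-- A Laplace transform which converges absolutely on the positive half-line is holomorphic on the
right half-plane. -/
theorem differentiableOn_laplace {X : Type*} [MeasurableSpace X] {μ : Measure X} {φ : X → ℝ}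
    {G : X → ℂ} (hφ : Measurable φ) (h0 : ∀ᵐ x ∂μ, 0 ≤ φ x) (hG : AEStronglyMeasurable G μ)
    (hint : ∀ σ : ℝ, 0 < σ → Integrable (fun x => Real.exp (-(σ * φ x)) * ‖G x‖) μ) :
    DifferentiableOn ℂ (fun z : ℂ => ∫ x, Complex.exp (-(z * φ x)) * G x ∂μ) {z | 0 < z.re} := by
  intro z₀ hz₀
  have hz₀' : 0 < z₀.re := hz₀
  have hmeas : ∀ z : ℂ, AEStronglyMeasurable (fun x => Complex.exp (-(z * φ x)) * G x) μ :=
    fun z => (Measurable.aestronglyMeasurable (by fun_prop)).mul hG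
  have hnorm : ∀ (z : ℂ) (x : X), ‖Complex.exp (-(z * φ x))‖ = Real.exp (-(z.re * φ x)) := by
    intro z x
    rw [Complex.norm_exp]; simp
  have key := hasDerivAt_integral_of_dominated_loc_of_deriv_le (μ := μ) (𝕜 := ℂ)
    (F := fun z x => Complex.exp (-(z * φ x)) * G x)
    (F' := fun z x => -(φ x : ℂ) * Complex.exp (-(z * φ x)) * G x) (x₀ := z₀)
    (s := Metric.ball z₀ (z₀.re / 2))
    -- On the ball `re z ≥ re z₀ / 2`. Half of this decay absorbs the factor `φ` produced by
    -- differentiation, through `φ ≤ (4 / re z₀) exp (re z₀ φ / 4)`; the other half remains in the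
    -- bound.
    (bound := fun x => (4 / z₀.re) * (Real.exp (-(z₀.re / 4 * φ x)) * ‖G x‖))
    (Metric.ball_mem_nhds _ (by positivity)) (Eventually.of_forall hmeas)
    ((hint z₀.re hz₀').mono' (hmeas _) (Eventually.of_forall fun x => by
      rw [norm_mul, hnorm]))
    ((Measurable.aestronglyMeasurable (by fun_prop)).mul hG)
    ?_ ((hint _ (by positivity)).const_mul _) ?_
  · exact key.2.differentiableAt.differentiableWithinAt
  · filter_upwards [h0] with x hx z hz
    have hre : z₀.re / 2 ≤ z.re := by
      have h1 : |(z - z₀).re| ≤ ‖z - z₀‖ := Complex.abs_re_le_norm _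
      rw [Metric.mem_ball, dist_eq_norm] at hz
      have := abs_le.1 h1
      simp at this
      linarith
    rw [norm_mul, norm_mul, hnorm, norm_neg, Complex.norm_real, Real.norm_of_nonneg hx, ← mul_assoc]
    refine mul_le_mul_of_nonneg_right ?_ (norm_nonneg _)
    have h2 : φ x ≤ 4 / z₀.re * Real.exp (z₀.re / 4 * φ x) := by
      have := Real.add_one_le_exp (z₀.re / 4 * φ x)
      rw [div_mul_eq_mul_div, le_div_iff₀ hz₀']
      linarith
    have h3 : Real.exp (-(z.re * φ x)) ≤ Real.exp (-(z₀.re / 2 * φ x)) := by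
      apply Real.exp_le_exp.2
      nlinarith
    calc φ x * Real.exp (-(z.re * φ x))
        ≤ (4 / z₀.re * Real.exp (z₀.re / 4 * φ x)) * Real.exp (-(z₀.re / 2 * φ x)) := by gcongr
      _ = _ := by rw [mul_assoc, ← Real.exp_add]; ring_nf
  · refine Eventually.of_forall fun x z _ => ?_
    have h := ((((hasDerivAt_id z).mul_const (φ x : ℂ)).neg).cexp).mul_const (G x)
    refine h.congr_deriv ?_
    simp only [id, Pi.neg_apply]
    ring

/-- Two holomorphic functions on the right half-plane that agree on the positive reals are equal. -/
theorem eqOn_rightHalfPlane {f g : ℂ → ℂ} (hf : DifferentiableOn ℂ f {z | 0 < z.re})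
    (hg : DifferentiableOn ℂ g {z | 0 < z.re}) (h : ∀ x : ℝ, 0 < x → f x = g x) :
    EqOn f g {z | 0 < z.re} := by
  have hopen : IsOpen {z : ℂ | 0 < z.re} := isOpen_lt continuous_const Complex.continuous_re
  have hconv : Convex ℝ {z : ℂ | 0 < z.re} := convex_halfSpace_re_gt 0
  refine AnalyticOnNhd.eqOn_of_preconnected_of_frequently_eq (hf.analyticOnNhd hopen)
    (hg.analyticOnNhd hopen) hconv.isPreconnected (z₀ := 1) (by simp) ?_
  have hseq : Tendsto (fun n : ℕ => ((1 + 1 / ((n : ℝ) + 1) : ℝ) : ℂ)) atTop (𝓝[≠] (1 : ℂ)) := by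
    rw [tendsto_nhdsWithin_iff]
    constructor
    · have h1 : Tendsto (fun n : ℕ => (1 + 1 / ((n : ℝ) + 1) : ℝ)) atTop (𝓝 (1 + 0)) :=
        tendsto_const_nhds.add tendsto_one_div_add_atTop_nhds_zero_nat
      rw [add_zero] at h1
      simpa [Function.comp_def] using (Complex.continuous_ofReal.tendsto _).comp h1
    · refine Eventually.of_forall fun n hn => ?_
      have : (1 + 1 / ((n : ℝ) + 1) : ℝ) = 1 := by
        rw [mem_singleton_iff] at hn
        exact_mod_cast hn
      have hpos : 0 < 1 / ((n : ℝ) + 1) := by positivity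
      linarith
  exact hseq.frequently (Frequently.of_forall fun n => h _ (by positivity))

/-- The Gamma integral with a complex rate. -/
theorem integral_exp_neg_mul_rpow {α : ℝ} (hα : 0 < α) {z : ℂ} (hz : 0 < z.re) :
    ∫ t in Ioi (0 : ℝ), Complex.exp (-(z * t)) * ((t ^ (α - 1) : ℝ) : ℂ) =
      (Real.Gamma α : ℂ) * z ^ (-(α : ℂ)) := by
  have hint : ∀ σ : ℝ, 0 < σ →
      IntegrableOn (fun t : ℝ => Real.exp (-(σ * t)) * t ^ (α - 1)) (Ioi 0) := by
    intro σ hσ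
    have := integrableOn_rpow_mul_exp_neg_mul_rpow (p := 1) (s := α - 1) (b := σ) (by linarith)
      one_pos hσ
    simpa [mul_comm] using this
  refine eqOn_rightHalfPlane
    (f := fun z : ℂ => ∫ t in Ioi (0 : ℝ), Complex.exp (-(z * t)) * ((t ^ (α - 1) : ℝ) : ℂ))
    (g := fun z : ℂ => (Real.Gamma α : ℂ) * z ^ (-(α : ℂ))) ?_ ?_ ?_ hz
  · refine differentiableOn_laplace (φ := fun t : ℝ => t) measurable_id
      ((ae_restrict_mem measurableSet_Ioi).mono fun t ht => le_of_lt ht)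
      (Measurable.aestronglyMeasurable (by fun_prop)) fun σ hσ => ?_
    refine (hint σ hσ).congr ?_
    filter_upwards [ae_restrict_mem measurableSet_Ioi] with t ht
    rw [Complex.norm_real, Real.norm_of_nonneg (Real.rpow_nonneg (le_of_lt ht) _)]
  · intro w hw
    have : w ∈ Complex.slitPlane := Or.inl hw
    exact ((differentiableAt_id.cpow_const this).const_mul _).differentiableWithinAt
  · intro x hx
    have := Real.integral_rpow_mul_exp_neg_mul_Ioi hα hx
    have h2 : ∫ t in Ioi (0 : ℝ), Complex.exp (-((x : ℂ) * t)) * ((t ^ (α - 1) : ℝ) : ℂ) =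
        ((∫ t in Ioi (0 : ℝ), t ^ (α - 1) * Real.exp (-(x * t)) : ℝ) : ℂ) := by
      rw [← integral_complex_ofReal]
      congr 1
      ext t
      push_cast
      ring
    rw [h2, this, one_div, Real.inv_rpow hx.le, ← Real.rpow_neg hx.le]
    push_cast [Complex.ofReal_cpow hx.le]
    ring

/-! ### The Fourier transform of `exp (-s|y|)` by subordination to Gaussians -/

theorem integrable_exp_neg_norm {E : Type*} [NormedAddCommGroup E] [NormedSpace ℝ E]
    [FiniteDimensional ℝ E] [MeasurableSpace E] [BorelSpace E] (μ : Measure E) [μ.IsAddHaarMeasure]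
    {σ : ℝ} (hσ : 0 < σ) : Integrable (fun y : E => Real.exp (-(σ * ‖y‖))) μ := by
  set r : ℕ := Module.finrank ℝ E + 1
  have h1 := (integrable_one_add_norm (μ := μ) (E := E) (r := r) (by simp [r]))
  have hb : ∃ C : ℝ, ∀ t : ℝ, 0 ≤ t → Real.exp (-(σ * t)) ≤ C * (1 + t) ^ (-(r : ℝ)) := by
    -- The constant comes from the single Taylor term `x ^ r / r! ≤ exp x` at `x = σ (1 + t)`.
    -- Taking `r` one above the dimension makes `(1 + ‖y‖) ^ (-r)` integrable.
    refine ⟨Real.exp σ * (r.factorial / σ ^ r), fun t ht => ?_⟩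
    have h2 := Real.pow_div_factorial_le_exp (σ * (1 + t)) (by positivity) r
    rw [Real.rpow_neg (by positivity), Real.rpow_natCast]
    have h3 : Real.exp (σ * (1 + t)) = Real.exp σ * Real.exp (σ * t) := by
      rw [← Real.exp_add]; ring_nf
    rw [h3, mul_pow] at h2
    rw [Real.exp_neg]
    have h4 : (0 : ℝ) < r.factorial := by positivity
    rw [div_le_iff₀ h4] at h2
    rw [← one_div, div_le_iff₀ (Real.exp_pos _)]
    have : Real.exp σ * (r.factorial / σ ^ r) * ((1 + t) ^ r)⁻¹ * Real.exp (σ * t) =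
      (Real.exp σ * Real.exp (σ * t) * r.factorial) / (σ ^ r * (1 + t) ^ r) := by
        field_simp
    rw [this, le_div_iff₀ (by positivity)]
    linarith
  obtain ⟨C, hC⟩ := hb
  refine (h1.const_mul C).mono' (Continuous.aestronglyMeasurable (by fun_prop))
    (Eventually.of_forall fun y => ?_)
  rw [Real.norm_of_nonneg (Real.exp_pos _).le]
  exact hC _ (norm_nonneg _)

/-- Subordination of the exponential to Gaussians. -/
theorem exp_neg_abs_eq_integral_gaussian (x : ℝ) :
    (Real.exp (-|x|) : ℂ) = ∫ u in Ioi (0 : ℝ),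
      (((Real.pi * u) ^ (-(1 / 2) : ℝ) * Real.exp (-u) * Real.exp (-(x ^ 2 / (4 * u))) : ℝ) : ℂ) := by
  set f : ℝ → ℂ := fun x => (Real.exp (-|x|) : ℂ) with hf
  have hfi : Integrable f := by
    have := integrable_exp_neg_norm (volume : Measure ℝ) one_pos
    simp only [one_mul, Real.norm_eq_abs] at this
    exact this.ofReal
  have hfc : Continuous f := by fun_prop
  have hF : ∀ v : ℝ, FourierTransform.fourier f v = ((2 * (1 + (2 * Real.pi * v) ^ 2)⁻¹ : ℝ) : ℂ) := by
    intro v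
    rw [Real.fourier_real_eq_integral_exp_smul]
    have hint : Integrable (fun w : ℝ => Complex.exp (↑(-2 * Real.pi * w * v) * Complex.I) • f w) := by
      refine hfi.norm.mono' (Continuous.aestronglyMeasurable (by fun_prop))
        (Eventually.of_forall fun w => ?_)
      rw [norm_smul, Complex.norm_exp_ofReal_mul_I, one_mul]
    rw [← intervalIntegral.integral_Iic_add_Ioi hint.integrableOn hint.integrableOn (b := 0)]
    have h1 : ∫ w in Iic (0 : ℝ), Complex.exp (↑(-2 * Real.pi * w * v) * Complex.I) • f w =
        ∫ w in Iic (0 : ℝ), Complex.exp ((1 - 2 * Real.pi * v * Complex.I) * w) := by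
      refine setIntegral_congr_fun measurableSet_Iic fun w hw => ?_
      simp only [hf, abs_of_nonpos (mem_Iic.1 hw), smul_eq_mul]
      push_cast
      rw [← Complex.exp_add]
      congr 1
      ring
    have h2 : ∫ w in Ioi (0 : ℝ), Complex.exp (↑(-2 * Real.pi * w * v) * Complex.I) • f w =
        ∫ w in Ioi (0 : ℝ), Complex.exp ((-1 - 2 * Real.pi * v * Complex.I) * w) := by
      refine setIntegral_congr_fun measurableSet_Ioi fun w hw => ?_
      simp only [hf, abs_of_pos (mem_Ioi.1 hw), smul_eq_mul]
      push_cast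
      rw [← Complex.exp_add]
      congr 1
      ring
    rw [h1, h2, integral_exp_mul_complex_Iic (by simp), integral_exp_mul_complex_Ioi (by simp)]
    set a : ℂ := 2 * Real.pi * v * Complex.I with ha
    have hre : a.re = 0 := by simp [ha]
    have e1 : 1 - a ≠ 0 := by
      intro h
      have := congrArg Complex.re h
      simp [hre] at this
    have e2 : -1 - a ≠ 0 := by
      intro h
      have := congrArg Complex.re h
      simp [hre] at this
    have e3 : (1 + (2 * Real.pi * v) ^ 2 : ℂ) = -((1 - a) * (-1 - a)) := by
      rw [ha]
      linear_combination ((2 * Real.pi * v : ℂ) ^ 2) * Complex.I_sq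
    push_cast
    rw [e3]
    simp only [mul_zero, Complex.exp_zero]
    field_simp
    ring
  have hFi : Integrable (FourierTransform.fourier f) := by
    have h1 := (integrable_inv_one_add_sq.comp_mul_left' (R := 2 * Real.pi) (by positivity)).const_mul 2
    exact h1.ofReal.congr (Eventually.of_forall fun v => (hF v).symm)
  have hinv := hfi.fourierInv_fourier_eq hFi (v := x) hfc.continuousAt
  rw [Real.fourierInv_eq'] at hinv
  have hx : f x = (Real.exp (-|x|) : ℂ) := rfl
  rw [← hx, ← hinv]
  -- The transform `2 / (1 + (2πv)²)` is a Laplace integral in `u` of Gaussians in `v`. Fourier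
  -- inversion, Fubini with this kernel, and the Gaussian integral in `v` then give the formula.
  set K : ℝ → ℝ → ℂ := fun v u => Complex.exp (Complex.I * (2 * Real.pi * x : ℝ) * v) *
    ((2 * Real.exp (-((1 + (2 * Real.pi * v) ^ 2) * u)) : ℝ) : ℂ) with hK
  have hKn : ∀ v u, ‖K v u‖ = 2 * Real.exp (-((1 + (2 * Real.pi * v) ^ 2) * u)) := by
    intro v u
    rw [hK, norm_mul, Complex.norm_real, Real.norm_of_nonneg (by positivity)]
    have : Complex.I * (2 * Real.pi * x : ℝ) * v = ((2 * Real.pi * x * v : ℝ) : ℂ) * Complex.I := by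
      push_cast; ring
    rw [this, Complex.norm_exp_ofReal_mul_I, one_mul]
  have hlap : ∀ v : ℝ, ∫ u in Ioi (0 : ℝ), 2 * Real.exp (-((1 + (2 * Real.pi * v) ^ 2) * u)) =
      2 * (1 + (2 * Real.pi * v) ^ 2)⁻¹ := by
    intro v
    have := integral_exp_mul_Ioi (a := -(1 + (2 * Real.pi * v) ^ 2)) (by
      have : 0 ≤ (2 * Real.pi * v) ^ 2 := by positivity
      linarith) 0
    rw [integral_const_mul]
    simp only [neg_mul] at this
    rw [this, neg_div_neg_eq]
    simp
  have hlapi : ∀ v : ℝ, IntegrableOn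
      (fun u : ℝ => 2 * Real.exp (-((1 + (2 * Real.pi * v) ^ 2) * u))) (Ioi 0) := by
    intro v
    have := (integrableOn_exp_mul_Ioi (a := -(1 + (2 * Real.pi * v) ^ 2)) (by
      have : 0 ≤ (2 * Real.pi * v) ^ 2 := by positivity
      linarith) 0).const_mul 2
    simp only [neg_mul] at this
    exact this
  have hKc : Continuous (Function.uncurry K) := by
    rw [hK]
    simp only [Function.uncurry_def]
    fun_prop
  have hKi : Integrable (Function.uncurry K) (volume.prod (volume.restrict (Ioi (0 : ℝ)))) := by
    rw [integrable_prod_iff hKc.aestronglyMeasurable]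
    constructor
    · refine Eventually.of_forall fun v => ?_
      exact (hlapi v).mono' (by apply Continuous.aestronglyMeasurable; fun_prop)
        (Eventually.of_forall fun u => (hKn v u).le)
    · have h1 := (integrable_inv_one_add_sq.comp_mul_left' (R := 2 * Real.pi)
        (by positivity)).const_mul 2
      refine h1.congr (Eventually.of_forall fun v => ?_)
      simp only [Function.uncurry_def, hKn]
      exact (hlap v).symm
  have hstep : ∀ v : ℝ, Complex.exp (↑(2 * Real.pi * inner ℝ v x) * Complex.I) •
      FourierTransform.fourier f v = ∫ u in Ioi (0 : ℝ), K v u := by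
    intro v
    rw [hF, ← hlap, ← integral_complex_ofReal, smul_eq_mul, ← integral_const_mul]
    simp only [hK]
    congr 1
    ext u
    congr 2
    simp
    ring
  simp_rw [hstep]
  rw [integral_integral_swap hKi]
  refine setIntegral_congr_fun measurableSet_Ioi fun u hu => ?_
  have hu' : 0 < u := hu
  have hb : 0 < ((4 * Real.pi ^ 2 * u : ℝ) : ℂ).re := by
    rw [Complex.ofReal_re]; positivity
  have hg := fourierIntegral_gaussian hb ((2 * Real.pi * x : ℝ) : ℂ)
  have h1 : ∫ v : ℝ, K v u = (2 * Real.exp (-u) : ℝ) * ∫ v : ℝ,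
      Complex.exp (Complex.I * (2 * Real.pi * x : ℝ) * v) *
        Complex.exp (-(4 * Real.pi ^ 2 * u : ℝ) * (v : ℂ) ^ 2) := by
    rw [← integral_const_mul]
    congr 1
    ext v
    have : Real.exp (-((1 + (2 * Real.pi * v) ^ 2) * u)) =
        Real.exp (-u) * Real.exp (-(4 * Real.pi ^ 2 * u) * v ^ 2) := by
      rw [← Real.exp_add]; ring_nf
    rw [hK]
    simp only [this]
    push_cast
    ring
  rw [h1, hg]
  have h2 : ((Real.pi : ℂ) / ((4 * Real.pi ^ 2 * u : ℝ) : ℂ)) ^ (1 / 2 : ℂ) =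
      (((1 / 2) * (Real.pi * u) ^ (-(1 / 2) : ℝ) : ℝ) : ℂ) := by
    have e1 : Real.pi / (4 * Real.pi ^ 2 * u) = (1 / 2) ^ (2 : ℝ) * (Real.pi * u)⁻¹ := by
      have := Real.pi_pos.ne'
      norm_num
      field_simp
    have e2 : (Real.pi / (4 * Real.pi ^ 2 * u)) ^ (1 / 2 : ℝ) =
        (1 / 2) * (Real.pi * u) ^ (-(1 / 2) : ℝ) := by
      rw [e1, Real.mul_rpow (by positivity) (by positivity), ← Real.rpow_mul (by norm_num),
        Real.inv_rpow (by positivity), Real.rpow_neg (by positivity)]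
      norm_num
    rw [← e2, Complex.ofReal_cpow (by positivity)]
    push_cast
    rfl
  rw [h2]
  have h3 : -((2 * Real.pi * x : ℝ) : ℂ) ^ 2 / (4 * ((4 * Real.pi ^ 2 * u : ℝ) : ℂ)) =
      ((-(x ^ 2 / (4 * u)) : ℝ) : ℂ) := by
    have := Real.pi_pos.ne'
    have hpi : (Real.pi : ℂ) ≠ 0 := by exact_mod_cast this
    have hu2 : (u : ℂ) ≠ 0 := by exact_mod_cast hu'.ne'
    push_cast
    field_simp
    ring
  rw [h3]
  push_cast
  ring

section Poisson

variable {E : Type*} [NormedAddCommGroup E] [InnerProductSpace ℝ E] [FiniteDimensional ℝ E]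
  [MeasurableSpace E] [BorelSpace E]

/-- Subordination at `s ‖y‖` turns the integrand into a mixture of Gaussians in `y`. After Fubini
their transforms are explicit, and what is left is a Gamma integral in `u` with rate `1 + ‖η‖² /
s²`. -/
theorem integral_exp_neg_mul_norm_of_pos (η : E) {s : ℝ} (hs : 0 < s) :
    ∫ y : E, Complex.exp (-((s : ℂ) * ‖y‖)) * Complex.exp (-(Complex.I * (inner ℝ y η : ℝ))) =
      ((Real.pi ^ (-(1 / 2) : ℝ) * (4 * Real.pi) ^ ((Module.finrank ℝ E : ℝ) / 2) *
        Real.Gamma (((Module.finrank ℝ E : ℝ) + 1) / 2) : ℝ) : ℂ) *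
        ((s * (s ^ 2 + ‖η‖ ^ 2) ^ (-(((Module.finrank ℝ E : ℝ) + 1) / 2)) : ℝ) : ℂ) := by
  set n : ℝ := (Module.finrank ℝ E : ℝ) with hn
  have hn0 : 0 ≤ n := by positivity
  set w : ℝ → ℝ := fun u => (Real.pi * u) ^ (-(1 / 2) : ℝ) * Real.exp (-u) with hw
  set K : E → ℝ → ℂ := fun y u => ((w u * Real.exp (-(s ^ 2 / (4 * u)) * ‖y‖ ^ 2) : ℝ) : ℂ) *
    Complex.exp (-(Complex.I * (inner ℝ y η : ℝ))) with hK
  have hphase : ∀ y : E, ‖Complex.exp (-(Complex.I * (inner ℝ y η : ℝ)))‖ = 1 := by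
    intro y
    rw [Complex.norm_exp]; simp
  have hw0 : ∀ u : ℝ, 0 < u → 0 ≤ w u := fun u hu => by rw [hw]; positivity
  have hKn : ∀ (y : E) (u : ℝ), 0 < u → ‖K y u‖ = w u * Real.exp (-(s ^ 2 / (4 * u)) * ‖y‖ ^ 2) := by
    intro y u hu
    rw [hK, norm_mul, hphase, mul_one, Complex.norm_real,
      Real.norm_of_nonneg (mul_nonneg (hw0 u hu) (Real.exp_pos _).le)]
  have hstep : ∀ y : E, Complex.exp (-((s : ℂ) * ‖y‖)) *
      Complex.exp (-(Complex.I * (inner ℝ y η : ℝ))) = ∫ u in Ioi (0 : ℝ), K y u := by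
    intro y
    have h1 := exp_neg_abs_eq_integral_gaussian (s * ‖y‖)
    rw [abs_of_nonneg (by positivity)] at h1
    have h2 : Complex.exp (-((s : ℂ) * ‖y‖)) = (Real.exp (-(s * ‖y‖)) : ℂ) := by push_cast; rfl
    rw [h2, h1, hK, integral_mul_const]
    congr 2
    ext u
    simp only [hw]
    congr 3
    ring
  have hKm : Measurable (Function.uncurry K) := by
    rw [hK]
    simp only [Function.uncurry_def, hw]
    fun_prop
  have hgr : ∀ u : ℝ, 0 < u → ∫ y : E, Real.exp (-(s ^ 2 / (4 * u)) * ‖y‖ ^ 2) =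
      (Real.pi / (s ^ 2 / (4 * u))) ^ (n / 2) := fun u hu =>
    GaussianFourier.integral_rexp_neg_mul_sq_norm (by positivity)
  have hgi : ∀ u : ℝ, 0 < u → Integrable (fun y : E => Real.exp (-(s ^ 2 / (4 * u)) * ‖y‖ ^ 2)) := by
    intro u hu
    -- The integral of a non-integrable function is `0` by convention, so the positive value already
    -- computed forces integrability.
    by_contra h
    have h1 := hgr u hu
    rw [integral_undef h] at h1
    have : 0 < (Real.pi / (s ^ 2 / (4 * u))) ^ (n / 2) := by positivity
    linarith
  have hpow : ∀ u : ℝ, 0 < u → (Real.pi * u) ^ (-(1 / 2) : ℝ) *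
      (Real.pi / (s ^ 2 / (4 * u))) ^ (n / 2) =
      (Real.pi ^ (-(1 / 2) : ℝ) * (4 * Real.pi) ^ (n / 2) * s ^ (-n)) * u ^ ((n + 1) / 2 - 1) := by
    intro u hu
    have e : Real.pi / (s ^ 2 / (4 * u)) = (4 * Real.pi) * u * (s ^ (2 : ℝ))⁻¹ := by
      rw [Real.rpow_two]
      field_simp
    rw [e, Real.mul_rpow (by positivity) (by positivity), Real.mul_rpow (by positivity) (by positivity),
      Real.mul_rpow (by positivity) (by positivity), Real.inv_rpow (by positivity),
      ← Real.rpow_mul hs.le, ← Real.rpow_neg hs.le]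
    have e2 : u ^ ((n + 1) / 2 - 1) = u ^ (-(1 / 2) : ℝ) * u ^ (n / 2) := by
      rw [← Real.rpow_add hu]; ring_nf
    rw [e2]
    ring_nf
  have hKi : Integrable (Function.uncurry K) (volume.prod (volume.restrict (Ioi (0 : ℝ)))) := by
    rw [integrable_prod_iff' hKm.aestronglyMeasurable]
    constructor
    · filter_upwards [ae_restrict_mem measurableSet_Ioi] with u hu
      exact ((hgi u hu).const_mul (w u)).mono' (hKm.comp (by fun_prop)).aestronglyMeasurable
        (Eventually.of_forall fun y => (hKn y u hu).le)
    · have h1 := integrableOn_rpow_mul_exp_neg_mul_rpow (p := 1) (s := (n + 1) / 2 - 1) (b := 1)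
        (by linarith) one_pos one_pos
      refine (h1.const_mul (Real.pi ^ (-(1 / 2) : ℝ) * (4 * Real.pi) ^ (n / 2) * s ^ (-n))).congr ?_
      filter_upwards [ae_restrict_mem measurableSet_Ioi] with u hu
      have : ∫ y : E, ‖Function.uncurry K (y, u)‖ =
          ∫ y : E, w u * Real.exp (-(s ^ 2 / (4 * u)) * ‖y‖ ^ 2) := by
        congr 1
        ext y
        exact hKn y u hu
      rw [this, integral_const_mul, hgr u hu, hw]
      simp only [Real.rpow_one, neg_mul, one_mul]
      linear_combination (-Real.exp (-u)) * hpow u hu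
  simp_rw [hstep]
  rw [integral_integral_swap hKi]
  have hinner : ∀ u : ℝ, 0 < u → ∫ y : E, K y u =
      (((Real.pi ^ (-(1 / 2) : ℝ) * (4 * Real.pi) ^ (n / 2) * s ^ (-n)) *
        (u ^ ((n + 1) / 2 - 1) * Real.exp (-((1 + ‖η‖ ^ 2 / s ^ 2) * u))) : ℝ) : ℂ) := by
    intro u hu
    have hb : 0 < ((s ^ 2 / (4 * u) : ℝ) : ℂ).re := by rw [Complex.ofReal_re]; positivity
    have hg := GaussianFourier.integral_cexp_neg_mul_sq_norm_add hb (-Complex.I) η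
    have h1 : ∫ y : E, K y u = (w u : ℂ) * ∫ y : E,
        Complex.exp (-((s ^ 2 / (4 * u) : ℝ) : ℂ) * ‖y‖ ^ 2 + -Complex.I * (inner ℝ η y : ℝ)) := by
      rw [← integral_const_mul]
      congr 1
      ext y
      rw [Complex.exp_add, hK, real_inner_comm]
      push_cast
      ring_nf
    rw [h1, hg]
    have h2 : ((Real.pi : ℂ) / ((s ^ 2 / (4 * u) : ℝ) : ℂ)) ^ ((Module.finrank ℝ E : ℂ) / 2) =
        (((Real.pi / (s ^ 2 / (4 * u))) ^ (n / 2) : ℝ) : ℂ) := by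
      rw [Complex.ofReal_cpow (by positivity), hn]
      push_cast
      rfl
    have h3 : (-Complex.I) ^ 2 * (‖η‖ : ℂ) ^ 2 / (4 * ((s ^ 2 / (4 * u) : ℝ) : ℂ)) =
        ((-(‖η‖ ^ 2 / s ^ 2 * u) : ℝ) : ℂ) := by
      have hs2 : (s : ℂ) ≠ 0 := by exact_mod_cast hs.ne'
      have hu2 : (u : ℂ) ≠ 0 := by exact_mod_cast hu.ne'
      rw [neg_sq, Complex.I_sq]
      push_cast
      field_simp
    rw [h2, h3, ← Complex.ofReal_exp, ← Complex.ofReal_mul, ← Complex.ofReal_mul]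
    congr 1
    rw [← mul_assoc _ (u ^ _), ← hpow u hu, hw]
    have : Real.exp (-((1 + ‖η‖ ^ 2 / s ^ 2) * u)) =
        Real.exp (-u) * Real.exp (-(‖η‖ ^ 2 / s ^ 2 * u)) := by
      rw [← Real.exp_add]; ring_nf
    rw [this]
    ring
  rw [setIntegral_congr_fun measurableSet_Ioi fun u hu => hinner u hu, integral_complex_ofReal,
    integral_const_mul, Real.integral_rpow_mul_exp_neg_mul_Ioi (by positivity) (by positivity),
    ← Complex.ofReal_mul]
  congr 1
  have e : 1 + ‖η‖ ^ 2 / s ^ 2 = (s ^ 2 + ‖η‖ ^ 2) * (s ^ (2 : ℝ))⁻¹ := by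
    rw [Real.rpow_two]; field_simp
  have e2 : (1 / (1 + ‖η‖ ^ 2 / s ^ 2)) ^ ((n + 1) / 2) =
      (s ^ 2 + ‖η‖ ^ 2) ^ (-((n + 1) / 2)) * s ^ (n + 1) := by
    rw [one_div, Real.inv_rpow (by positivity), ← Real.rpow_neg (by positivity), e,
      Real.mul_rpow (by positivity) (by positivity), Real.inv_rpow (by positivity),
      ← Real.rpow_mul hs.le, ← Real.rpow_neg hs.le]
    ring_nf
  have e3 : s ^ (-n) * s ^ (n + 1) = s := by
    rw [← Real.rpow_add hs]; simp
  rw [e2]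
  linear_combination (Real.pi ^ (-(1 / 2) : ℝ) * (4 * Real.pi) ^ (n / 2) *
    (s ^ 2 + ‖η‖ ^ 2) ^ (-((n + 1) / 2)) * Real.Gamma ((n + 1) / 2)) * e3

/-- The square of a point of the right half-plane avoids the closed negative half-line, and a shift
to the right cannot bring it there. This makes the principal power in the Poisson formula
holomorphic in `s`. -/
theorem sq_add_ofReal_mem_slitPlane {z : ℂ} (hz : 0 < z.re) {b : ℝ} (hb : 0 ≤ b) :
    z ^ 2 + (b : ℂ) ∈ Complex.slitPlane := by
  rw [Complex.mem_slitPlane_iff]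
  by_cases h : z.im = 0
  · left
    simp [pow_two, h]
    positivity
  · right
    simp [pow_two]
    intro h'
    have : z.re * z.im = 0 := by linarith
    rcases mul_eq_zero.1 this with h1 | h1
    · exact hz.ne' h1
    · exact h h1

/-- The Fourier transform of `exp (-s|y|)` for complex `s` in the right half-plane. -/
theorem exists_integral_exp_neg_mul_norm (E : Type*) [NormedAddCommGroup E] [InnerProductSpace ℝ E]
    [FiniteDimensional ℝ E] [MeasurableSpace E] [BorelSpace E] :
    ∃ C : ℝ, 0 < C ∧ ∀ (η : E) (s : ℂ), 0 < s.re →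
      ∫ y : E, Complex.exp (-(s * ‖y‖)) * Complex.exp (-(Complex.I * (inner ℝ y η : ℝ))) =
        C * (s * (s ^ 2 + (‖η‖ : ℂ) ^ 2) ^ (-((((Module.finrank ℝ E : ℝ) + 1) / 2 : ℝ) : ℂ))) := by
  refine ⟨Real.pi ^ (-(1 / 2) : ℝ) * (4 * Real.pi) ^ ((Module.finrank ℝ E : ℝ) / 2) *
        Real.Gamma (((Module.finrank ℝ E : ℝ) + 1) / 2), ?_, fun η s hs => ?_⟩
  · have := Real.Gamma_pos_of_pos (s := ((Module.finrank ℝ E : ℝ) + 1) / 2) (by positivity)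
    positivity
  refine eqOn_rightHalfPlane (f := fun s : ℂ =>
    ∫ y : E, Complex.exp (-(s * ‖y‖)) * Complex.exp (-(Complex.I * (inner ℝ y η : ℝ))))
    (g := fun s : ℂ => ((Real.pi ^ (-(1 / 2) : ℝ) *
      (4 * Real.pi) ^ ((Module.finrank ℝ E : ℝ) / 2) *
        Real.Gamma (((Module.finrank ℝ E : ℝ) + 1) / 2) : ℝ) : ℂ) *
      (s * (s ^ 2 + (‖η‖ : ℂ) ^ 2) ^ (-((((Module.finrank ℝ E : ℝ) + 1) / 2 : ℝ) : ℂ))))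
    ?_ ?_ ?_ hs
  · refine differentiableOn_laplace (φ := fun y : E => ‖y‖) measurable_norm
      (Eventually.of_forall fun y => norm_nonneg y)
      (Continuous.aestronglyMeasurable (by fun_prop)) fun σ hσ => ?_
    refine (integrable_exp_neg_norm (volume : Measure E) hσ).congr (Eventually.of_forall fun y => ?_)
    simp only
    rw [Complex.norm_exp]
    simp
  · intro z hz
    have h1 := sq_add_ofReal_mem_slitPlane hz (sq_nonneg ‖η‖)
    push_cast at h1
    have h2 : DifferentiableAt ℂ (fun s : ℂ => s ^ 2 + (‖η‖ : ℂ) ^ 2) z := by fun_prop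
    exact ((differentiableAt_id.mul (h2.cpow_const h1)).const_mul _).differentiableWithinAt
  · intro x hx
    rw [integral_exp_neg_mul_norm_of_pos η hx, Complex.ofReal_mul x, Complex.ofReal_cpow (by positivity)]
    push_cast
    rfl

end Poisson

/-! ### Gamma densities and the limiting radial integral -/

/-- Parseval's formula `∫ ĝ Ĥ = ∫ g(t) H(-t) dt`, by Fourier inversion of the convolution. -/
theorem integral_fourier_mul_fourier {g H : ℝ → ℂ} (hg : Integrable g) (hH : Integrable H)
    (hgH : Integrable (fun v => FourierTransform.fourier g v * FourierTransform.fourier H v))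
    (hc : ContinuousAt (fun x => ∫ t, g t * H (x - t)) 0) :
    ∫ v, FourierTransform.fourier g v * FourierTransform.fourier H v = ∫ t, g t * H (-t) := by
  set h : ℝ → ℂ := convolution g H (ContinuousLinearMap.mul ℂ ℂ) volume with hh
  have hF : FourierTransform.fourier h =
      fun v => FourierTransform.fourier g v * FourierTransform.fourier H v := by
    ext v
    exact Real.fourier_mul_convolution_eq hg hH v
  have hi : Integrable h := hg.integrable_convolution (ContinuousLinearMap.mul ℂ ℂ) hH
  have hc' : ContinuousAt h 0 := hc
  have := hi.fourierInv_fourier_eq (by rw [hF]; exact hgH) hc'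
  rw [Real.fourierInv_eq', hF] at this
  simpa [hh, convolution_def] using this

/-- The (unnormalised) Gamma density `t^(α-1) e^{-bt}` on the positive half-line. -/
noncomputable def gammaKernel (α b : ℝ) (t : ℝ) : ℂ :=
  (Ioi (0 : ℝ)).indicator (fun t => Complex.exp (-(b * t)) * ((t ^ (α - 1) : ℝ) : ℂ)) t

theorem gammaKernel_integrable {α b : ℝ} (hα : 0 < α) (hb : 0 < b) :
    Integrable (gammaKernel α b) := by
  unfold gammaKernel
  rw [integrable_indicator_iff measurableSet_Ioi]
  have h1 := integrableOn_rpow_mul_exp_neg_mul_rpow (p := 1) (s := α - 1) (b := b) (by linarith)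
      one_pos hb
  refine h1.ofReal.congr (Eventually.of_forall fun t => ?_)
  simp only [Real.rpow_one]
  rw [← Complex.ofReal_mul, ← Complex.ofReal_neg, ← Complex.ofReal_exp, ← Complex.ofReal_mul,
    mul_comm, neg_mul]
  rfl

theorem fourier_gammaKernel {α b : ℝ} (hα : 0 < α) (hb : 0 < b) (v : ℝ) :
    FourierTransform.fourier (gammaKernel α b) v =
      (Real.Gamma α : ℂ) * (b + 2 * Real.pi * v * Complex.I) ^ (-(α : ℂ)) := by
  rw [← integral_exp_neg_mul_rpow hα (by simpa using hb), Real.fourier_real_eq_integral_exp_smul,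
    ← integral_indicator measurableSet_Ioi]
  congr 1
  ext t
  by_cases ht : t ∈ Ioi (0 : ℝ)
  · simp only [gammaKernel, indicator_of_mem ht, smul_eq_mul]
    rw [← mul_assoc, ← Complex.exp_add]
    push_cast
    ring_nf
  · simp [gammaKernel, indicator_of_notMem ht]

theorem continuousAt_gammaKernel (α b : ℝ) {t : ℝ} (ht : t ≠ 0) :
    ContinuousAt (gammaKernel α b) t := by
  rcases lt_or_gt_of_ne ht with h | h
  · refine (continuousAt_const (y := (0 : ℂ))).congr ?_
    filter_upwards [Iio_mem_nhds h] with x hx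
    rw [gammaKernel, indicator_of_notMem (by simpa using le_of_lt (mem_Iio.1 hx))]
  · have : ContinuousAt (fun t : ℝ => Complex.exp (-(b * t)) * ((t ^ (α - 1) : ℝ) : ℂ)) t := by
      have h1 := Complex.continuous_ofReal.continuousAt.comp
        (Real.continuousAt_rpow_const t (α - 1) (Or.inl ht))
      exact (Continuous.continuousAt (by fun_prop)).mul h1
    refine this.congr ?_
    filter_upwards [Ioi_mem_nhds h] with x hx
    rw [gammaKernel, indicator_of_mem hx]

/-- Boundedness of one factor provides the majorant for the continuity at `0` of the convolution in
Parseval's formula. It rests on the Taylor term `(b t) ^ m / m! ≤ exp (b t)` with `m = k - 1`. -/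
theorem exists_norm_gammaKernel_natCast_le {k : ℕ} (hk : 1 ≤ k) {b : ℝ} (hb : 0 < b) :
    ∃ M : ℝ, ∀ t, ‖gammaKernel k b t‖ ≤ M := by
  obtain ⟨m, rfl⟩ := Nat.exists_eq_add_of_le' hk
  refine ⟨m.factorial / b ^ m, fun t => ?_⟩
  by_cases ht : t ∈ Ioi (0 : ℝ)
  · have ht' : 0 < t := ht
    rw [gammaKernel, indicator_of_mem ht, norm_mul, Complex.norm_real, Complex.norm_exp]
    have h1 := Real.pow_div_factorial_le_exp (b * t) (by positivity) m
    push_cast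
    rw [add_sub_cancel_right, Real.rpow_natCast, Real.norm_of_nonneg (by positivity)]
    have : (-(b * t : ℂ)).re = -(b * t) := by simp
    rw [this, Real.exp_neg, le_div_iff₀ (by positivity), inv_mul_eq_div, div_mul_eq_mul_div,
      div_le_iff₀ (Real.exp_pos _)]
    rw [div_le_iff₀ (by positivity), mul_pow] at h1
    linarith
  · rw [gammaKernel, indicator_of_notMem ht, norm_zero]
    positivity

/-- Decay of order `1/|v|` is all that is available when `α = 1`; two such factors multiply to
exactly `1 / (1 + v²)`, which covers the extreme case `d = 2`, `k = 1`. -/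
theorem exists_norm_cpow_le {α b : ℝ} (hα : 1 ≤ α) (hb : 0 < b) :
    ∃ C : ℝ, 0 ≤ C ∧ ∀ v : ℝ, ‖((b : ℂ) + 2 * Real.pi * v * Complex.I) ^ (-(α : ℂ))‖ ≤
      C * (Real.sqrt (1 + v ^ 2))⁻¹ := by
  set m := min b 1 with hm
  have hm0 : 0 < m := lt_min hb one_pos
  refine ⟨m ^ (-α), by positivity, fun v => ?_⟩
  have hS : 1 ≤ Real.sqrt (1 + v ^ 2) := Real.one_le_sqrt.2 (by nlinarith)
  have h1 : m * Real.sqrt (1 + v ^ 2) ≤ ‖((b : ℂ) + 2 * Real.pi * v * Complex.I)‖ := by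
    have h2 : ‖((b : ℂ) + 2 * Real.pi * v * Complex.I)‖ = Real.sqrt (b ^ 2 + (2 * Real.pi * v) ^ 2) := by
      have := Complex.norm_add_mul_I b (2 * Real.pi * v)
      push_cast at this
      exact this
    rw [h2]
    refine Real.le_sqrt_of_sq_le ?_
    rw [mul_pow, Real.sq_sqrt (by positivity)]
    have h3 : m ^ 2 ≤ b ^ 2 := pow_le_pow_left₀ hm0.le (min_le_left _ _) 2
    have h4 : m ^ 2 ≤ (2 * Real.pi) ^ 2 :=
      pow_le_pow_left₀ hm0.le ((min_le_right _ _).trans (by linarith [Real.pi_gt_three])) 2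
    nlinarith [sq_nonneg v]
  have h5 : (-(α : ℂ)) = ((-α : ℝ) : ℂ) := by push_cast; rfl
  rw [h5, Complex.norm_cpow_real]
  calc _ ≤ (m * Real.sqrt (1 + v ^ 2)) ^ (-α) :=
        Real.rpow_le_rpow_of_nonpos (by positivity) h1 (by linarith)
    _ = m ^ (-α) * Real.sqrt (1 + v ^ 2) ^ (-α) := Real.mul_rpow hm0.le (by positivity)
    _ ≤ m ^ (-α) * Real.sqrt (1 + v ^ 2) ^ (-1 : ℝ) := by
        gcongr
    _ = _ := by rw [Real.rpow_neg_one]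

theorem integrable_cpow_mul_cpow {α β a b : ℝ} (hα : 1 ≤ α) (hβ : 1 ≤ β) (ha : 0 < a) (hb : 0 < b)
    (σ : ℝ) (hσ : |σ| = 1) :
    Integrable (fun v : ℝ => ((a : ℂ) + 2 * Real.pi * v * Complex.I) ^ (-(α : ℂ)) *
      ((b : ℂ) + 2 * Real.pi * (σ * v : ℝ) * Complex.I) ^ (-(β : ℂ))) := by
  obtain ⟨C, hC0, hC⟩ := exists_norm_cpow_le hα ha
  obtain ⟨D, hD0, hD⟩ := exists_norm_cpow_le hβ hb
  have hcont : ∀ {c γ : ℝ}, 0 < c →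
      Continuous (fun v : ℝ => ((c : ℂ) + 2 * Real.pi * v * Complex.I) ^ (-(γ : ℂ))) := by
    intro c γ hc
    refine Continuous.cpow (by fun_prop) continuous_const fun v => Or.inl ?_
    simpa using hc
  refine (integrable_inv_one_add_sq.const_mul (C * D)).mono'
    ((hcont ha).mul ((hcont hb).comp (continuous_const.mul continuous_id))).aestronglyMeasurable
    (Eventually.of_forall fun v => ?_)
  rw [norm_mul]
  refine (mul_le_mul (hC v) (hD (σ * v)) (norm_nonneg _) (by positivity)).trans_eq ?_
  have : (σ * v) ^ 2 = v ^ 2 := by rw [mul_pow, ← sq_abs σ, hσ]; ring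
  rw [this]
  have h2 : Real.sqrt (1 + v ^ 2) * Real.sqrt (1 + v ^ 2) = 1 + v ^ 2 :=
    Real.mul_self_sqrt (by positivity)
  rw [mul_mul_mul_comm, ← mul_inv, h2]

/-- Parseval for two Gamma densities replaces closing a contour. The sign `σ` reflects the second
density, and so decides whether the supports in the pairing are opposite or equal. -/
theorem integral_fourier_gammaKernel {α b : ℝ} (hα : 1 ≤ α) {k : ℕ} (hk : 1 ≤ k) (hb : 0 < b)
    (σ : ℝ) (hσ : |σ| = 1) :
    (Real.Gamma α : ℂ) * Real.Gamma k * ∫ v : ℝ, ((1 : ℝ) + 2 * Real.pi * v * Complex.I) ^ (-(α : ℂ)) *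
      ((b : ℂ) + 2 * Real.pi * (σ * v : ℝ) * Complex.I) ^ (-((k : ℝ) : ℂ)) =
    ∫ t, gammaKernel α 1 t * gammaKernel k b (-(σ * t)) := by
  have hk' : (1 : ℝ) ≤ k := by exact_mod_cast hk
  have hσ2 : σ * σ = 1 := by rw [← abs_mul_abs_self, hσ]; norm_num
  have hσ0 : σ ≠ 0 := by rintro rfl; simp at hσ
  set H : ℝ → ℂ := fun t => gammaKernel k b (σ * t) with hH
  have hHi : Integrable H := (gammaKernel_integrable (by linarith) hb).comp_mul_left' hσ0
  have hFH : ∀ v, FourierTransform.fourier H v = (Real.Gamma k : ℂ) *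
      ((b : ℂ) + 2 * Real.pi * (σ * v : ℝ) * Complex.I) ^ (-((k : ℝ) : ℂ)) := by
    intro v
    rw [← fourier_gammaKernel (by linarith) hb, Real.fourier_real_eq_integral_exp_smul,
      Real.fourier_real_eq_integral_exp_smul]
    have := Measure.integral_comp_mul_left (fun t : ℝ =>
      Complex.exp (↑(-2 * Real.pi * t * (σ * v)) * Complex.I) • gammaKernel k b t) σ
    rw [abs_inv, hσ, inv_one, one_smul] at this
    rw [← this]
    congr 1
    ext t
    have e : -2 * Real.pi * (σ * t) * (σ * v) = -2 * Real.pi * t * v := by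
      linear_combination (-2 * Real.pi * t * v) * hσ2
    rw [e]
  have h1 := integral_fourier_mul_fourier (gammaKernel_integrable (α := α) (by linarith) one_pos) hHi
    ?_ ?_
  · simp only [hH, mul_neg] at h1
    rw [← h1, ← integral_const_mul]
    congr 1
    ext v
    rw [fourier_gammaKernel (by linarith) one_pos, hFH]
    ring
  · refine ((integrable_cpow_mul_cpow hα hk' one_pos hb σ hσ).const_mul
      ((Real.Gamma α : ℂ) * Real.Gamma k)).congr (Eventually.of_forall fun v => ?_)
    simp only
    rw [fourier_gammaKernel (by linarith) one_pos, hFH]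
    ring
  · obtain ⟨M, hM⟩ := exists_norm_gammaKernel_natCast_le hk hb
    refine continuousAt_of_dominated (bound := fun t => ‖gammaKernel α 1 t‖ * M)
      (Eventually.of_forall fun x => ?_) (Eventually.of_forall fun x => Eventually.of_forall fun t => ?_)
      ((gammaKernel_integrable (by linarith) one_pos).norm.mul_const M) ?_
    · exact (gammaKernel_integrable (by linarith) one_pos).1.mul
        (hHi.comp_sub_left x).1
    · rw [norm_mul]
      exact mul_le_mul_of_nonneg_left (hM _) (norm_nonneg _)
    -- The density of order `k = 1` jumps at the origin, but this affects only the null set `t = 0`.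
    · have : ∀ᵐ t : ℝ, t ≠ 0 := Measure.ae_ne volume 0
      filter_upwards [this] with t ht
      refine continuousAt_const.mul ?_
      have h2 : ContinuousAt (gammaKernel k b) (σ * (0 - t)) :=
        continuousAt_gammaKernel _ _ (by simpa using ⟨hσ0, ht⟩)
      exact ContinuousAt.comp (f := fun x : ℝ => σ * (x - t)) h2 (by fun_prop)

/-- The arguments `π/2` of `2i` and `arg w ∈ (-π/2, π/2)` add up to less than `π`, so the principal
logarithm is additive here. -/
theorem mul_cpow_of_re_pos {w : ℂ} (hw : 0 < w.re) (α : ℂ) :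
    (2 * Complex.I * w) ^ α = (2 * Complex.I) ^ α * w ^ α := by
  have hw0 : w ≠ 0 := by rintro rfl; simp at hw
  have h2I : (2 * Complex.I : ℂ) ≠ 0 := by simp
  have harg : Complex.arg (2 * Complex.I) = Real.pi / 2 := by
    have := Complex.arg_real_mul Complex.I (two_pos)
    push_cast at this
    rw [this, Complex.arg_I]
  have hargw := abs_lt.1 (Complex.abs_arg_lt_pi_div_two_iff.2 (Or.inl hw))
  rw [Complex.cpow_def_of_ne_zero (mul_ne_zero h2I hw0), Complex.log_mul h2I hw0 ?_,
    Complex.cpow_def_of_ne_zero h2I, Complex.cpow_def_of_ne_zero hw0, ← Complex.exp_add]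
  · ring_nf
  · rw [harg]
    constructor <;> linarith

/-- The limiting radial integral: it vanishes for `u > 0`. -/
theorem integral_cpow_mul_pow_of_pos {α : ℝ} (hα : 1 ≤ α) {k : ℕ} (hk : 1 ≤ k) {u : ℝ} (hu : 0 < u) :
    ∫ r : ℝ, (2 * (r : ℂ) + 2 * Complex.I) ^ (-(α : ℂ)) *
      ((2 * (r : ℂ) + 2 * Complex.I * u) ^ k)⁻¹ = 0 := by
  have h1 := integral_fourier_gammaKernel hα hk hu 1 (by simp)
  have h2 : ∀ t, gammaKernel α 1 t * gammaKernel k u (-(1 * t)) = 0 := by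
    intro t
    by_cases ht : 0 < t
    · have : gammaKernel k u (-(1 * t)) = 0 := by
        rw [gammaKernel, indicator_of_notMem]
        simp; linarith
      rw [this, mul_zero]
    · have : gammaKernel α 1 t = 0 := by
        rw [gammaKernel, indicator_of_notMem]
        simpa using ht
      rw [this, zero_mul]
  have hG1 : (Real.Gamma α : ℂ) ≠ 0 := by
    exact_mod_cast (Real.Gamma_pos_of_pos (by linarith)).ne'
  have hG2 : (Real.Gamma k : ℂ) ≠ 0 := by
    exact_mod_cast (Real.Gamma_pos_of_pos (by exact_mod_cast hk)).ne'
  simp only [h2, integral_zero, mul_eq_zero, hG1, hG2, or_self, false_or] at h1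
  -- The substitution `r = -2πv` gives `2r + 2i = 2i (1 + 2πiv)` and `2r + 2iu = 2i (u + 2πiv)`, the
  -- forms of the transforms of the Gamma densities.
  have h3 := Measure.integral_comp_mul_left (fun r : ℝ =>
    (2 * (r : ℂ) + 2 * Complex.I) ^ (-(α : ℂ)) * ((2 * (r : ℂ) + 2 * Complex.I * u) ^ k)⁻¹)
    (-(2 * Real.pi))
  have h4 : ∫ v : ℝ, (2 * ((-(2 * Real.pi) * v : ℝ) : ℂ) + 2 * Complex.I) ^ (-(α : ℂ)) *
      ((2 * ((-(2 * Real.pi) * v : ℝ) : ℂ) + 2 * Complex.I * u) ^ k)⁻¹ =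
      (2 * Complex.I) ^ (-(α : ℂ)) * ((2 * Complex.I) ^ k)⁻¹ *
      ∫ v : ℝ, ((1 : ℝ) + 2 * Real.pi * v * Complex.I) ^ (-(α : ℂ)) *
      ((u : ℂ) + 2 * Real.pi * (1 * v : ℝ) * Complex.I) ^ (-((k : ℝ) : ℂ)) := by
    rw [← integral_const_mul]
    congr 1
    ext v
    have e1 : (2 * ((-(2 * Real.pi) * v : ℝ) : ℂ) + 2 * Complex.I) =
        2 * Complex.I * ((1 : ℝ) + 2 * Real.pi * v * Complex.I) := by
      push_cast
      linear_combination (-(4 * Real.pi * v : ℂ)) * Complex.I_sq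
    have e2 : (2 * ((-(2 * Real.pi) * v : ℝ) : ℂ) + 2 * Complex.I * u) =
        2 * Complex.I * (u + 2 * Real.pi * (1 * v : ℝ) * Complex.I) := by
      push_cast
      linear_combination (-(4 * Real.pi * v : ℂ)) * Complex.I_sq
    rw [e1, e2, mul_cpow_of_re_pos (by simp), Complex.cpow_neg _ ((k : ℝ) : ℂ), Complex.ofReal_natCast,
      Complex.cpow_natCast, mul_pow, mul_inv]
    ring
  rw [h4, h1, mul_zero] at h3
  refine (smul_eq_zero.1 h3.symm).resolve_left (abs_ne_zero.2 (inv_ne_zero (neg_ne_zero.2 ?_)))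
  positivity

/-- The limiting radial integral for `u < 0`. -/
theorem exists_integral_cpow_mul_pow_of_neg {α : ℝ} (hα : 1 ≤ α) {k : ℕ} (hk : 1 ≤ k) :
    ∃ κ : ℂ, κ ≠ 0 ∧ ∀ u : ℝ, u < 0 →
    ∫ r : ℝ, (2 * (r : ℂ) + 2 * Complex.I) ^ (-(α : ℂ)) *
      ((2 * (r : ℂ) + 2 * Complex.I * u) ^ k)⁻¹ = κ * ((1 - u) ^ (-(α + k - 1)) : ℝ) := by
  have hk' : (1 : ℝ) ≤ k := by exact_mod_cast hk
  have hG1 : (Real.Gamma α : ℂ) ≠ 0 := by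
    exact_mod_cast (Real.Gamma_pos_of_pos (by linarith)).ne'
  have hG2 : (Real.Gamma k : ℂ) ≠ 0 := by
    exact_mod_cast (Real.Gamma_pos_of_pos (by linarith)).ne'
  have hG3 : (Real.Gamma (α + k - 1) : ℂ) ≠ 0 := by
    exact_mod_cast (Real.Gamma_pos_of_pos (by linarith)).ne'
  have hpi : (2 * Real.pi : ℂ) ≠ 0 := by
    have := Real.pi_pos.ne'
    exact_mod_cast (by positivity : (2 * Real.pi : ℝ) ≠ 0)
  have hI : (2 * Complex.I : ℂ) ≠ 0 := by simp
  refine ⟨2 * Real.pi * ((2 * Complex.I) ^ (-(α : ℂ)) * ((-(2 * Complex.I)) ^ k)⁻¹) *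
    ((Real.Gamma α : ℂ) * Real.Gamma k)⁻¹ * Real.Gamma (α + k - 1), ?_, fun u hu => ?_⟩
  · refine mul_ne_zero (mul_ne_zero (mul_ne_zero hpi (mul_ne_zero ?_ ?_)) ?_) hG3
    · rw [Ne, Complex.cpow_eq_zero_iff]; tauto
    · exact inv_ne_zero (pow_ne_zero _ (neg_ne_zero.2 hI))
    · exact inv_ne_zero (mul_ne_zero hG1 hG2)
  -- With rate `-u > 0` and the sign `-1` both densities live on `t > 0`; their product is `t^(α + k
  -- - 2) exp (-(1 - u) t)`, a Gamma integral.
  have h1 := integral_fourier_gammaKernel hα hk (b := -u) (by linarith) (-1) (by simp)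
  have h2 : ∫ t, gammaKernel α 1 t * gammaKernel k (-u) (-(-1 * t)) =
      ((Real.Gamma (α + k - 1) * (1 - u) ^ (-(α + k - 1)) : ℝ) : ℂ) := by
    have h3 := Real.integral_rpow_mul_exp_neg_mul_Ioi (a := α + k - 1) (r := 1 - u) (by linarith)
      (by linarith)
    rw [one_div, Real.inv_rpow (by linarith), ← Real.rpow_neg (by linarith), mul_comm] at h3
    rw [← h3, ← integral_complex_ofReal, ← integral_indicator measurableSet_Ioi]
    congr 1
    ext t
    by_cases ht : t ∈ Ioi (0 : ℝ)
    · have ht' : 0 < t := ht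
      simp only [gammaKernel, neg_mul, one_mul, neg_neg, indicator_of_mem ht]
      have e1 : t ^ (α + k - 1 - 1) = t ^ (α - 1) * t ^ ((k : ℝ) - 1) := by
        rw [← Real.rpow_add ht']; ring_nf
      have e2 : Real.exp (-((1 - u) * t)) = Real.exp (-t) * Real.exp (u * t) := by
        rw [← Real.exp_add]; ring_nf
      rw [e1, e2]
      push_cast
      ring_nf
    · simp [gammaKernel, indicator_of_notMem ht]
  rw [h2] at h1
  have h3 := Measure.integral_comp_mul_left (fun r : ℝ =>
    (2 * (r : ℂ) + 2 * Complex.I) ^ (-(α : ℂ)) * ((2 * (r : ℂ) + 2 * Complex.I * u) ^ k)⁻¹)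
    (-(2 * Real.pi))
  have h4 : ∫ v : ℝ, (2 * ((-(2 * Real.pi) * v : ℝ) : ℂ) + 2 * Complex.I) ^ (-(α : ℂ)) *
      ((2 * ((-(2 * Real.pi) * v : ℝ) : ℂ) + 2 * Complex.I * u) ^ k)⁻¹ =
      (2 * Complex.I) ^ (-(α : ℂ)) * ((-(2 * Complex.I)) ^ k)⁻¹ *
      ∫ v : ℝ, ((1 : ℝ) + 2 * Real.pi * v * Complex.I) ^ (-(α : ℂ)) *
      (((-u : ℝ) : ℂ) + 2 * Real.pi * (-1 * v : ℝ) * Complex.I) ^ (-((k : ℝ) : ℂ)) := by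
    rw [← integral_const_mul]
    congr 1
    ext v
    have e1 : (2 * ((-(2 * Real.pi) * v : ℝ) : ℂ) + 2 * Complex.I) =
        2 * Complex.I * ((1 : ℝ) + 2 * Real.pi * v * Complex.I) := by
      push_cast
      linear_combination (-(4 * Real.pi * v : ℂ)) * Complex.I_sq
    have e2 : (2 * ((-(2 * Real.pi) * v : ℝ) : ℂ) + 2 * Complex.I * u) =
        -(2 * Complex.I) * ((-u : ℝ) + 2 * Real.pi * (-1 * v : ℝ) * Complex.I) := by
      push_cast
      linear_combination (-(4 * Real.pi * v : ℂ)) * Complex.I_sq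
    rw [e1, e2, mul_cpow_of_re_pos (by simp), Complex.cpow_neg _ ((k : ℝ) : ℂ), Complex.ofReal_natCast,
      Complex.cpow_natCast, mul_pow, mul_inv]
    ring
  rw [h4] at h3
  set A := ∫ v : ℝ, ((1 : ℝ) + 2 * Real.pi * v * Complex.I) ^ (-(α : ℂ)) *
      (((-u : ℝ) : ℂ) + 2 * Real.pi * (-1 * v : ℝ) * Complex.I) ^ (-((k : ℝ) : ℂ)) with hA
  set B := ∫ r : ℝ, (2 * (r : ℂ) + 2 * Complex.I) ^ (-(α : ℂ)) *
      ((2 * (r : ℂ) + 2 * Complex.I * u) ^ k)⁻¹ with hB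
  have hA' : A = ((Real.Gamma α : ℂ) * Real.Gamma k)⁻¹ *
      ((Real.Gamma (α + k - 1) * (1 - u) ^ (-(α + k - 1)) : ℝ) : ℂ) := by
    rw [← h1]
    field_simp
  have hB' : B = 2 * Real.pi * ((2 * Complex.I) ^ (-(α : ℂ)) * ((-(2 * Complex.I)) ^ k)⁻¹ * A) := by
    rw [h3, abs_inv, abs_neg, abs_of_pos (by positivity), Complex.real_smul]
    push_cast
    field_simp
  rw [hB', hA']
  push_cast
  ring

/-! ### The dyadic cutoffs and elementary bounds for the multiplier -/

theorem abs_mem_Icc_of_ne_zero {ψ : ℝ → ℝ} (hψ : IsDyadicPartition ψ) {t : ℝ} (ht : ψ t ≠ 0) :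
    1 / 2 ≤ |t| ∧ |t| ≤ 2 := by
  have h := hψ.supp (subset_tsupport ψ ht)
  rcases h with h | h
  · rw [abs_of_nonpos (by linarith [h.2])]
    constructor <;> linarith [h.1, h.2]
  · rw [abs_of_nonneg (by linarith [h.1])]
    constructor <;> linarith [h.1, h.2]

theorem partition_zero {ψ : ℝ → ℝ} (hψ : IsDyadicPartition ψ) : ψ 0 = 0 := by
  by_contra h
  have := (abs_mem_Icc_of_ne_zero hψ h).1
  norm_num at this

theorem partition_le_one {ψ : ℝ → ℝ} (hψ : IsDyadicPartition ψ) (t : ℝ) : ψ t ≤ 1 := by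
  by_cases ht : t = 0
  · rw [ht, partition_zero hψ]; norm_num
  · have := le_hasSum (hψ.sum_eq_one t ht) 0 fun j _ => hψ.nonneg _
    simpa using this

/-- The limiting integral only sees `u < 0`; evenness ensures that `ψ` does not vanish identically
there. -/
theorem exists_neg_partition_ne_zero {ψ : ℝ → ℝ} (hψ : IsDyadicPartition ψ) :
    ∃ t : ℝ, t < 0 ∧ ψ t ≠ 0 := by
  have h1 : ∃ j : ℤ, ψ ((2 : ℝ) ^ (-j) * 1) ≠ 0 := by
    by_contra! h
    have := hψ.sum_eq_one 1 one_ne_zero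
    simp only [h] at this
    exact one_ne_zero (this.unique hasSum_zero)
  obtain ⟨j, hj⟩ := h1
  refine ⟨-((2 : ℝ) ^ (-j) * 1), ?_, by rwa [hψ.even]⟩
  have : (0 : ℝ) < (2 : ℝ) ^ (-j) := by positivity
  linarith

theorem summable_partition {ψ : ℝ → ℝ} (hψ : IsDyadicPartition ψ) (t : ℝ) :
    Summable (fun j : ℕ => ψ ((2 : ℝ) ^ (-((j : ℤ) + 1)) * t)) := by
  by_cases ht : t = 0
  · simp only [ht, mul_zero, partition_zero hψ]
    exact summable_zero
  · exact (hψ.sum_eq_one t ht).summable.comp_injective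
      (i := fun j : ℕ => (j : ℤ) + 1) (fun a b h => by simpa using h)

theorem lowPart_le_one {ψ : ℝ → ℝ} (hψ : IsDyadicPartition ψ) (t : ℝ) : lowPart ψ t ≤ 1 := by
  have : 0 ≤ ∑' j : ℕ, ψ ((2 : ℝ) ^ (-((j : ℤ) + 1)) * t) := tsum_nonneg fun j => hψ.nonneg _
  unfold lowPart
  linarith

theorem lowPart_nonneg {ψ : ℝ → ℝ} (hψ : IsDyadicPartition ψ) (t : ℝ) : 0 ≤ lowPart ψ t := by
  unfold lowPart
  by_cases ht : t = 0
  · simp [ht, partition_zero hψ]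
  · have h := hψ.sum_eq_one t ht
    have h1 := tsum_comp_le_tsum_of_inj h.summable (fun j => hψ.nonneg _)
      (i := fun j : ℕ => (j : ℤ) + 1) (fun a b h => by simpa using h)
    rw [h.tsum_eq] at h1
    have h2 : (∑' j : ℕ, ψ ((2 : ℝ) ^ (-((j : ℤ) + 1)) * t)) ≤ 1 := h1
    linarith

theorem lowPart_eq_one {ψ : ℝ → ℝ} (hψ : IsDyadicPartition ψ) {t : ℝ} (ht : |t| < 1) :
    lowPart ψ t = 1 := by
  have : ∀ j : ℕ, ψ ((2 : ℝ) ^ (-((j : ℤ) + 1)) * t) = 0 := by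
    intro j
    by_contra h
    have h1 := (abs_mem_Icc_of_ne_zero hψ h).1
    have h2 : (2 : ℝ) ^ (-((j : ℤ) + 1)) ≤ 2 ^ (-1 : ℤ) :=
      zpow_le_zpow_right₀ (by norm_num) (by omega)
    rw [abs_mul, abs_of_pos (by positivity)] at h1
    have h3 : (2 : ℝ) ^ (-((j : ℤ) + 1)) * |t| ≤ 2 ^ (-1 : ℤ) * |t| := by gcongr
    have h4 : (2 : ℝ) ^ (-1 : ℤ) = 1 / 2 := by norm_num
    rw [h4] at h3
    linarith
  rw [lowPart]
  simp only [this, tsum_zero, sub_zero]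

theorem lowPart_eq_zero {ψ : ℝ → ℝ} (hψ : IsDyadicPartition ψ) {t : ℝ} (ht : 2 < |t|) :
    lowPart ψ t = 0 := by
  have ht0 : t ≠ 0 := by rintro rfl; norm_num at ht
  have h := hψ.sum_eq_one t ht0
  have hinj : Function.Injective (fun j : ℕ => (j : ℤ) + 1) := fun a b h => by simpa using h
  rw [← hinj.hasSum_iff] at h
  · have h2 : (∑' j : ℕ, ψ ((2 : ℝ) ^ (-((j : ℤ) + 1)) * t)) = 1 := h.tsum_eq
    rw [lowPart, h2, sub_self]
  -- For `|t| > 2` the terms with `j ≤ 0` vanish, so the sum over `j ≥ 1` is already the full sum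
  -- `1`.
  · intro j hj
    by_contra h0
    have h1 := (abs_mem_Icc_of_ne_zero hψ h0).2
    have hj0 : j ≤ 0 := by
      by_contra hj'
      exact hj ⟨(j - 1).toNat, by simp only; omega⟩
    have h2 : (1 : ℝ) ≤ 2 ^ (-j) := one_le_zpow₀ (by norm_num) (by omega)
    rw [abs_mul, abs_of_pos (by positivity)] at h1
    nlinarith [abs_nonneg t]

theorem measurable_lowPart {ψ : ℝ → ℝ} (hψ : IsDyadicPartition ψ) : Measurable (lowPart ψ) := by
  have hm := hψ.smooth.continuous.measurable
  refine measurable_const.sub (measurable_of_tendsto_metrizable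
    (f := fun (N : ℕ) (t : ℝ) => ∑ j ∈ Finset.range N, ψ ((2 : ℝ) ^ (-((j : ℤ) + 1)) * t))
    (fun N => Finset.measurable_sum _ fun j _ => hm.comp (by fun_prop)) ?_)
  rw [tendsto_pi_nhds]
  exact fun t => (summable_partition hψ t).hasSum.tendsto_sum_nat

/-- The frequencies in the support of the multiplier. -/
theorem mEps_support {d k : ℕ} {ψ : ℝ → ℝ} (hψ : IsDyadicPartition ψ) {ε₀ ε : ℝ} (hε₀ : 0 < ε₀)
    (hε₀' : ε₀ ≤ 1 / 32) (hε : 0 < ε) {ξ : EucProd d} (h : mEps d k ψ ε₀ ε ξ ≠ 0) :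
    |1 - ‖ξ.1‖ ^ 2| ≤ 1 / 16 ∧ ε / 2 ≤ |ξ.2| ∧ |ξ.2| ≤ 2 * ε := by
  have h1 : lowPart ψ (ε₀⁻¹ * (1 - ‖ξ.1‖ ^ 2)) ≠ 0 := by
    intro h0; apply h; simp [mEps, h0]
  have h2 : ψ (ε⁻¹ * ξ.2) ≠ 0 := by
    intro h0; apply h; simp [mEps, h0]
  have h3 : |ε₀⁻¹ * (1 - ‖ξ.1‖ ^ 2)| ≤ 2 := by
    by_contra! h0
    exact h1 (lowPart_eq_zero hψ h0)
  obtain ⟨h4, h5⟩ := abs_mem_Icc_of_ne_zero hψ h2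
  rw [abs_mul, abs_of_pos (by positivity), inv_mul_eq_div] at h3 h4 h5
  rw [div_le_iff₀ (by positivity)] at h3 h5
  rw [le_div_iff₀ hε] at h4
  refine ⟨?_, ?_, ?_⟩ <;> linarith

theorem norm_mEps_le {d k : ℕ} {ψ : ℝ → ℝ} (hψ : IsDyadicPartition ψ) {ε₀ ε : ℝ} (hε₀ : 0 < ε₀)
    (hε₀' : ε₀ ≤ 1 / 32) (hε : 0 < ε) (ξ : EucProd d) :
    ‖mEps d k ψ ε₀ ε ξ‖ ≤ (ε ^ k)⁻¹ := by
  by_cases h : mEps d k ψ ε₀ ε ξ = 0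
  · rw [h, norm_zero]; positivity
  obtain ⟨-, h2, -⟩ := mEps_support hψ hε₀ hε₀' hε h
  -- The imaginary part `2τ` alone suffices, since `|τ| ≥ ε / 2` on the support.
  have hden : ε ≤ ‖(((‖ξ.1‖ ^ 2 - 1 + ξ.2 ^ 2 : ℝ) : ℂ) + 2 * Complex.I * (ξ.2 : ℂ))‖ := by
    refine le_trans ?_ (Complex.abs_im_le_norm _)
    rw [Complex.add_im, Complex.ofReal_im]
    simp [abs_mul]
    linarith
  rw [mEps, norm_div, norm_pow, Complex.norm_real, div_eq_mul_inv]
  have hnum : ‖lowPart ψ (ε₀⁻¹ * (1 - ‖ξ.1‖ ^ 2)) * ψ (ε⁻¹ * ξ.2)‖ ≤ 1 := by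
    rw [Real.norm_of_nonneg (mul_nonneg (lowPart_nonneg hψ _) (hψ.nonneg _))]
    exact mul_le_one₀ (lowPart_le_one hψ _) (hψ.nonneg _) (partition_le_one hψ _)
  calc _ ≤ 1 * (ε ^ k)⁻¹ := by gcongr
    _ = _ := one_mul _

theorem measurable_mEps {d k : ℕ} {ψ : ℝ → ℝ} (hψ : IsDyadicPartition ψ) (ε₀ ε : ℝ) :
    Measurable (mEps d k ψ ε₀ ε) := by
  have h1 : Measurable (fun ξ : EucProd d => lowPart ψ (ε₀⁻¹ * (1 - ‖ξ.1‖ ^ 2))) :=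
    (measurable_lowPart hψ).comp (by fun_prop)
  have h2 : Measurable (fun ξ : EucProd d => ψ (ε⁻¹ * ξ.2)) :=
    hψ.smooth.continuous.measurable.comp (by fun_prop)
  exact (Complex.measurable_ofReal.comp (h1.mul h2)).div (by fun_prop)

theorem integrable_mEps {d k : ℕ} {ψ : ℝ → ℝ} (hψ : IsDyadicPartition ψ) {ε₀ ε : ℝ} (hε₀ : 0 < ε₀)
    (hε₀' : ε₀ ≤ 1 / 32) (hε : 0 < ε) : Integrable (mEps d k ψ ε₀ ε) := by
  refine Measure.integrableOn_of_bounded (M := (ε ^ k)⁻¹)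
    (s := Metric.closedBall (0 : EucProd d) (2 + 2 * ε)) ?_
    (measurable_mEps hψ ε₀ ε).aestronglyMeasurable
    (Eventually.of_forall fun ξ => norm_mEps_le hψ hε₀ hε₀' hε ξ)
    |>.integrable_of_forall_notMem_eq_zero ?_
  · exact (isCompact_closedBall _ _).measure_lt_top.ne
  · intro ξ hξ
    by_contra h
    obtain ⟨h1, -, h3⟩ := mEps_support hψ hε₀ hε₀' hε h
    apply hξ
    rw [mem_closedBall_zero_iff, Prod.norm_def]
    have h4 := (abs_le.1 h1).1
    refine max_le ?_ ?_
    · nlinarith [norm_nonneg ξ.1]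
    · rw [Real.norm_eq_abs]; linarith

/-! ### The rescaled integral, its majorant and its nonzero limit -/

/-- Polar coordinates in the first variable, rescaled around the unit sphere. -/
theorem integral_radial_rescale {G : Type*} [NormedAddCommGroup G] [NormedSpace ℝ G] {d : ℕ}
    (hd : 2 ≤ d) {F : ℝ → ℝ → G} (hF : Integrable (fun ξ : EucProd d => F ‖ξ.1‖ ξ.2)) {ε : ℝ}
    (hε : 0 < ε) :
    ∫ ξ : EucProd d, F ‖ξ.1‖ ξ.2 =
      (((d - 1 : ℕ) : ℝ) * volume.real (Metric.ball (0 : EuclideanSpace ℝ (Fin (d - 1))) 1) * ε ^ 2) •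
        ∫ r : ℝ, ∫ u : ℝ, (if 0 < 1 + ε * r then (1 + ε * r) ^ (d - 2) else 0) •
          F (1 + ε * r) (ε * u) := by
  have : Nonempty (Fin (d - 1)) := ⟨⟨0, by omega⟩⟩
  have h1 : ∫ ξ : EucProd d, F ‖ξ.1‖ ξ.2 =
      ∫ η : EuclideanSpace ℝ (Fin (d - 1)), (fun ρ : ℝ => ∫ τ : ℝ, F ρ τ) ‖η‖ := integral_prod _ hF
  rw [h1, integral_fun_norm_addHaar (volume : Measure (EuclideanSpace ℝ (Fin (d - 1))))
    (fun ρ : ℝ => ∫ τ : ℝ, F ρ τ), finrank_euclideanSpace_fin, ← integral_indicator measurableSet_Ioi]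
  -- Extending the radial integrand by zero makes it a function on the whole line, where the change
  -- `y = 1 + ε r` only costs a factor `ε`.
  set Φ : ℝ → G := (Ioi (0 : ℝ)).indicator fun y => y ^ (d - 1 - 1) • ∫ τ : ℝ, F y τ with hΦ
  have h2 : ∫ y, Φ y = ε • ∫ r, Φ (1 + ε * r) := by
    have h3 := Measure.integral_comp_mul_left (fun r => Φ (1 + r)) ε
    rw [h3, integral_add_left_eq_self (fun r => Φ r) 1, smul_smul, abs_of_pos (by positivity),
      mul_inv_cancel₀ hε.ne', one_smul]
  have h4 : ∀ r : ℝ, Φ (1 + ε * r) = ε • ∫ u : ℝ,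
      (if 0 < 1 + ε * r then (1 + ε * r) ^ (d - 2) else 0) • F (1 + ε * r) (ε * u) := by
    intro r
    rw [integral_smul, Measure.integral_comp_mul_left (fun τ => F (1 + ε * r) τ) ε, hΦ]
    by_cases hr : 0 < 1 + ε * r
    · rw [indicator_of_mem (mem_Ioi.2 hr), if_pos hr, smul_smul, smul_smul, abs_of_pos (by positivity)]
      congr 1
      have : d - 1 - 1 = d - 2 := by omega
      rw [this]
      field_simp
    · rw [indicator_of_notMem (by simpa using hr), if_neg hr, zero_smul, smul_zero]
  rw [h2]
  simp_rw [h4]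
  rw [integral_smul, ← Nat.cast_smul_eq_nsmul ℝ, smul_smul, smul_smul, smul_smul]
  congr 1
  ring

/-- The weight in the rescaled multiplier integral. -/
noncomputable def scaledWeight (d : ℕ) (ψ : ℝ → ℝ) (ε₀ ε r u : ℝ) : ℝ :=
  (if 0 < 1 + ε * r then (1 + ε * r) ^ (d - 2) else 0) *
    (lowPart ψ (ε₀⁻¹ * (1 - (1 + ε * r) ^ 2)) * ψ u) * Real.exp (-u ^ 2 / 2)

/-- The integrand of the multiplier applied to the test function at the origin, in the rescaled
variables `|η| = 1 + ε r`, `τ = ε u`. -/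
noncomputable def scaledIntegrand (d k : ℕ) (ψ : ℝ → ℝ) (ε₀ ε r u : ℝ) : ℂ :=
  (scaledWeight d ψ ε₀ ε r u : ℂ) *
    ((((r * (2 + ε * r) + ε : ℝ) : ℂ) + 2 * Complex.I) ^ (-(((d : ℝ) / 2 : ℝ) : ℂ)) *
      ((((r * (2 + ε * r) + ε * u ^ 2 : ℝ) : ℂ) + 2 * Complex.I * u) ^ k)⁻¹)

/-- The pointwise limit of `scaledIntegrand` as `ε → 0`. -/
noncomputable def limitIntegrand (d k : ℕ) (ψ : ℝ → ℝ) (r u : ℝ) : ℂ :=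
  ((ψ u * Real.exp (-u ^ 2 / 2) : ℝ) : ℂ) *
    ((2 * (r : ℂ) + 2 * Complex.I) ^ (-(((d : ℝ) / 2 : ℝ) : ℂ)) *
      ((2 * (r : ℂ) + 2 * Complex.I * u) ^ k)⁻¹)

/-- An integrable majorant for `scaledIntegrand`. -/
noncomputable def scaledBound (d : ℕ) (r u : ℝ) : ℝ :=
  (2 ^ (d - 2) * 8) * (1 + r ^ 2)⁻¹ * (Icc (-2 : ℝ) 2).indicator 1 u

theorem measurable_scaledIntegrand {ψ : ℝ → ℝ} (hψ : IsDyadicPartition ψ) (d k : ℕ) (ε₀ ε : ℝ) :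
    Measurable (Function.uncurry (scaledIntegrand d k ψ ε₀ ε)) := by
  have h1 : Measurable (fun x : ℝ × ℝ => lowPart ψ (ε₀⁻¹ * (1 - (1 + ε * x.1) ^ 2))) :=
    (measurable_lowPart hψ).comp (by fun_prop)
  have h2 : Measurable (fun x : ℝ × ℝ => ψ x.2) :=
    hψ.smooth.continuous.measurable.comp measurable_snd
  have h3 : Measurable (fun x : ℝ × ℝ => if 0 < 1 + ε * x.1 then (1 + ε * x.1) ^ (d - 2) else 0) :=
    Measurable.ite (measurableSet_lt measurable_const (by fun_prop)) (by fun_prop) measurable_const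
  have h4 : Measurable (fun x : ℝ × ℝ => scaledWeight d ψ ε₀ ε x.1 x.2) :=
    (h3.mul (h1.mul h2)).mul (by fun_prop)
  exact (Complex.measurable_ofReal.comp h4).mul (by fun_prop)

theorem measurable_limitIntegrand {ψ : ℝ → ℝ} (hψ : IsDyadicPartition ψ) (d k : ℕ) :
    Measurable (Function.uncurry (limitIntegrand d k ψ)) := by
  have h2 : Measurable (fun x : ℝ × ℝ => ψ x.2) :=
    hψ.smooth.continuous.measurable.comp measurable_snd
  exact (Complex.measurable_ofReal.comp (h2.mul (by fun_prop))).mul (by fun_prop)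

/-- On the support `0 < 1 + ε r ≤ 2`, so `|r (2 + ε r)| ≥ |r|` and both bases grow at least linearly
in `r`; their imaginary parts `2` and `2u`, with `|u| ≥ 1/2`, keep them away from zero. As `d/2 ≥ 1`
and `k ≥ 1`, the product decays like `r^(-2)`, uniformly in `ε`. -/
theorem norm_scaledIntegrand_le {ψ : ℝ → ℝ} (hψ : IsDyadicPartition ψ) {d k : ℕ} (hd : 2 ≤ d)
    (hk : 1 ≤ k) {ε₀ ε : ℝ} (hε₀ : 0 < ε₀) (hε₀' : ε₀ ≤ 1 / 32) (hε : 0 < ε) (hε' : ε ≤ 1 / 4)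
    (r u : ℝ) : ‖scaledIntegrand d k ψ ε₀ ε r u‖ ≤ scaledBound d r u := by
  have hb0 : 0 ≤ scaledBound d r u := by
    unfold scaledBound
    refine mul_nonneg (by positivity) (indicator_nonneg (fun _ _ => zero_le_one) _)
  by_cases hw : scaledWeight d ψ ε₀ ε r u = 0
  · simpa [scaledIntegrand, hw] using hb0
  have hpos : 0 < 1 + ε * r := by
    by_contra h
    exact hw (by simp [scaledWeight, h])
  have hlow : lowPart ψ (ε₀⁻¹ * (1 - (1 + ε * r) ^ 2)) ≠ 0 := by
    intro h
    exact hw (by simp [scaledWeight, h])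
  have hψu : ψ u ≠ 0 := by
    intro h
    exact hw (by simp [scaledWeight, h])
  obtain ⟨hu1, hu2⟩ := abs_mem_Icc_of_ne_zero hψ hψu
  have h3 : |ε₀⁻¹ * (1 - (1 + ε * r) ^ 2)| ≤ 2 := by
    by_contra! h0
    exact hlow (lowPart_eq_zero hψ h0)
  rw [abs_mul, abs_of_pos (by positivity), inv_mul_eq_div, div_le_iff₀ hε₀] at h3
  have h4 := abs_le.1 h3
  have hy2 : 1 + ε * r ≤ 2 := by nlinarith
  have huI : u ∈ Icc (-2 : ℝ) 2 := abs_le.1 hu2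
  have hweight : |scaledWeight d ψ ε₀ ε r u| ≤ 2 ^ (d - 2) := by
    rw [scaledWeight, if_pos hpos, abs_of_nonneg (mul_nonneg (mul_nonneg (by positivity)
      (mul_nonneg (lowPart_nonneg hψ _) (hψ.nonneg _))) (by positivity))]
    have e1 : (1 + ε * r) ^ (d - 2) ≤ 2 ^ (d - 2) := pow_le_pow_left₀ hpos.le hy2 _
    have e2 : lowPart ψ (ε₀⁻¹ * (1 - (1 + ε * r) ^ 2)) * ψ u ≤ 1 :=
      mul_le_one₀ (lowPart_le_one hψ _) (hψ.nonneg _) (partition_le_one hψ _)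
    have e3 : Real.exp (-u ^ 2 / 2) ≤ 1 := Real.exp_le_one_iff.2 (by nlinarith)
    have e4 : 0 ≤ lowPart ψ (ε₀⁻¹ * (1 - (1 + ε * r) ^ 2)) * ψ u :=
      mul_nonneg (lowPart_nonneg hψ _) (hψ.nonneg _)
    calc _ ≤ (2 : ℝ) ^ (d - 2) * 1 * 1 := by gcongr
      _ = _ := by ring
  have hre : |r| ≤ |r * (2 + ε * r)| := by
    rw [abs_mul]
    have : 1 ≤ |2 + ε * r| := by
      rw [abs_of_pos (by linarith)]; linarith
    nlinarith [abs_nonneg r]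
  set z₁ : ℂ := ((r * (2 + ε * r) + ε : ℝ) : ℂ) + 2 * Complex.I with hz₁
  set z₂ : ℂ := ((r * (2 + ε * r) + ε * u ^ 2 : ℝ) : ℂ) + 2 * Complex.I * u with hz₂
  have hz₁re : z₁.re = r * (2 + ε * r) + ε := by
    rw [hz₁, Complex.add_re, Complex.ofReal_re]; simp
  have hz₁im : z₁.im = 2 := by
    rw [hz₁, Complex.add_im, Complex.ofReal_im]; simp
  have hz₂re : z₂.re = r * (2 + ε * r) + ε * u ^ 2 := by
    rw [hz₂, Complex.add_re, Complex.ofReal_re]; simp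
  have hz₂im : z₂.im = 2 * u := by
    rw [hz₂, Complex.add_im, Complex.ofReal_im]; simp
  have hn₁ : 2 ≤ ‖z₁‖ := by
    have := Complex.abs_im_le_norm z₁
    rw [hz₁im] at this
    norm_num at this
    exact this
  have hn₁' : |r| - 1 ≤ ‖z₁‖ := by
    have := Complex.abs_re_le_norm z₁
    rw [hz₁re] at this
    have h5 := abs_sub_abs_le_abs_sub (r * (2 + ε * r)) (-ε)
    rw [abs_neg, abs_of_pos hε, sub_neg_eq_add] at h5
    linarith
  have hn₂ : 1 ≤ ‖z₂‖ := by
    have := Complex.abs_im_le_norm z₂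
    rw [hz₂im, abs_mul] at this
    norm_num at this
    linarith
  have hn₂' : |r| - 1 ≤ ‖z₂‖ := by
    have := Complex.abs_re_le_norm z₂
    rw [hz₂re] at this
    have h5 := abs_sub_abs_le_abs_sub (r * (2 + ε * r)) (-(ε * u ^ 2))
    rw [abs_neg, abs_of_nonneg (show 0 ≤ ε * u ^ 2 by positivity), sub_neg_eq_add] at h5
    have : u ^ 2 ≤ 4 := by rw [← sq_abs]; nlinarith [abs_nonneg u]
    nlinarith
  -- The bound from the imaginary part is used for `|r| ≤ 3`, the one from the real part for `|r| ≥
  -- 3`.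
  have hb₁ : (1 + |r|) / 2 ≤ ‖z₁‖ := by
    rcases le_total |r| 3 with h | h <;> linarith
  have hb₂ : (1 + |r|) / 4 ≤ ‖z₂‖ := by
    rcases le_total |r| 3 with h | h <;> linarith
  have hp₁ : ‖z₁ ^ (-(((d : ℝ) / 2 : ℝ) : ℂ))‖ ≤ 2 / (1 + |r|) := by
    rw [← Complex.ofReal_neg, Complex.norm_cpow_real]
    have hd' : (2 : ℝ) ≤ d := by exact_mod_cast hd
    calc ‖z₁‖ ^ (-((d : ℝ) / 2)) ≤ ‖z₁‖ ^ (-1 : ℝ) :=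
          Real.rpow_le_rpow_of_exponent_le (by linarith) (by linarith)
      _ = ‖z₁‖⁻¹ := Real.rpow_neg_one _
      _ ≤ ((1 + |r|) / 2)⁻¹ := by gcongr
      _ = _ := by rw [inv_div]
  have hp₂ : ‖(z₂ ^ k)⁻¹‖ ≤ 4 / (1 + |r|) := by
    rw [norm_inv, norm_pow]
    calc (‖z₂‖ ^ k)⁻¹ ≤ ‖z₂‖⁻¹ := by
          gcongr
          exact le_self_pow₀ hn₂ (by omega)
      _ ≤ ((1 + |r|) / 4)⁻¹ := by gcongr
      _ = _ := by rw [inv_div]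
  rw [scaledIntegrand, ← hz₁, ← hz₂, norm_mul, norm_mul, Complex.norm_real, Real.norm_eq_abs, scaledBound,
    indicator_of_mem huI]
  calc _ ≤ 2 ^ (d - 2) * (2 / (1 + |r|) * (4 / (1 + |r|))) := by gcongr
    _ = (2 ^ (d - 2) * 8) * ((1 + |r|) ^ 2)⁻¹ := by field_simp; norm_num
    _ ≤ (2 ^ (d - 2) * 8) * (1 + r ^ 2)⁻¹ := by
        gcongr
        rw [← sq_abs]
        nlinarith [abs_nonneg r]
    _ = _ := by simp

theorem tendsto_scaledIntegrand {ψ : ℝ → ℝ} (hψ : IsDyadicPartition ψ) (d k : ℕ)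
    (ε₀ : ℝ) (r u : ℝ) :
    Tendsto (fun ε => scaledIntegrand d k ψ ε₀ ε r u) (𝓝[>] 0) (𝓝 (limitIntegrand d k ψ r u)) := by
  by_cases hu : ψ u = 0
  · simp [scaledIntegrand, limitIntegrand, scaledWeight, hu]
  have hu0 : u ≠ 0 := by
    rintro rfl
    exact hu (partition_zero hψ)
  refine Tendsto.mono_left ?_ nhdsWithin_le_nhds
  have hc : ∀ {f : ℝ → ℝ}, Continuous f → Tendsto f (𝓝 0) (𝓝 (f 0)) := fun h => h.tendsto 0
  have h1 : ∀ᶠ ε in 𝓝 (0 : ℝ), 0 < 1 + ε * r := by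
    have := hc (f := fun ε => 1 + ε * r) (by fun_prop)
    exact this.eventually (lt_mem_nhds (by norm_num))
  have h2 : ∀ᶠ ε in 𝓝 (0 : ℝ), |ε₀⁻¹ * (1 - (1 + ε * r) ^ 2)| < 1 := by
    have := hc (f := fun ε => |ε₀⁻¹ * (1 - (1 + ε * r) ^ 2)|) (by fun_prop)
    exact this.eventually (gt_mem_nhds (by norm_num))
  have hw : Tendsto (fun ε => scaledWeight d ψ ε₀ ε r u) (𝓝 0)
      (𝓝 (ψ u * Real.exp (-u ^ 2 / 2))) := by
    have h3 := hc (f := fun ε => (1 + ε * r) ^ (d - 2) * ψ u * Real.exp (-u ^ 2 / 2)) (by fun_prop)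
    simp only [zero_mul, add_zero, one_pow, one_mul] at h3
    refine h3.congr' ?_
    filter_upwards [h1, h2] with ε he1 he2
    rw [scaledWeight, if_pos he1, lowPart_eq_one hψ he2, one_mul]
  have hz₁ : Tendsto (fun ε : ℝ => ((r * (2 + ε * r) + ε : ℝ) : ℂ) + 2 * Complex.I) (𝓝 0)
      (𝓝 (2 * (r : ℂ) + 2 * Complex.I)) := by
    have : Continuous (fun ε : ℝ => ((r * (2 + ε * r) + ε : ℝ) : ℂ) + 2 * Complex.I) := by fun_prop
    convert this.tendsto 0 using 2
    push_cast
    ring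
  have hz₂ : Tendsto (fun ε : ℝ => ((r * (2 + ε * r) + ε * u ^ 2 : ℝ) : ℂ) + 2 * Complex.I * u) (𝓝 0)
      (𝓝 (2 * (r : ℂ) + 2 * Complex.I * u)) := by
    have : Continuous (fun ε : ℝ => ((r * (2 + ε * r) + ε * u ^ 2 : ℝ) : ℂ) + 2 * Complex.I * u) := by
      fun_prop
    convert this.tendsto 0 using 2
    push_cast
    ring
  have hs : (2 * (r : ℂ) + 2 * Complex.I) ∈ Complex.slitPlane := by
    right; simp
  have hne : (2 * (r : ℂ) + 2 * Complex.I * u) ≠ 0 := by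
    intro h
    have := congrArg Complex.im h
    simp [hu0] at this
  refine ((Complex.continuous_ofReal.tendsto _).comp hw).mul (Tendsto.mul ?_ ?_)
  · exact (continuousAt_cpow_const hs).tendsto.comp hz₁
  · exact (hz₂.pow k).inv₀ (pow_ne_zero _ hne)

theorem integrable_scaledBound (d : ℕ) :
    Integrable (Function.uncurry (scaledBound d)) (volume.prod volume) := by
  have h1 : Integrable (fun r : ℝ => (2 ^ (d - 2) * 8) * (1 + r ^ 2)⁻¹) :=
    integrable_inv_one_add_sq.const_mul _
  have h2 : Integrable ((Icc (-2 : ℝ) 2).indicator (1 : ℝ → ℝ)) := by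
    rw [integrable_indicator_iff measurableSet_Icc]
    exact integrableOn_const (by simp)
  exact h1.mul_prod h2

theorem norm_limitIntegrand_le {ψ : ℝ → ℝ} (hψ : IsDyadicPartition ψ) {d k : ℕ} (hd : 2 ≤ d)
    (hk : 1 ≤ k) (r u : ℝ) : ‖limitIntegrand d k ψ r u‖ ≤ scaledBound d r u := by
  -- The limit does not depend on `ε₀`, so any admissible value, here `1 / 32`, transfers the
  -- majorant.
  refine le_of_tendsto (tendsto_scaledIntegrand hψ d k (1 / 32) r u).norm ?_
  have : Ioc (0 : ℝ) (1 / 4) ∈ 𝓝[>] (0 : ℝ) := Ioc_mem_nhdsGT (by norm_num)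
  filter_upwards [this] with ε hε
  exact norm_scaledIntegrand_le hψ hd hk (by norm_num) le_rfl hε.1 hε.2 r u

theorem integrable_limitIntegrand {ψ : ℝ → ℝ} (hψ : IsDyadicPartition ψ) {d k : ℕ} (hd : 2 ≤ d)
    (hk : 1 ≤ k) : Integrable (Function.uncurry (limitIntegrand d k ψ)) (volume.prod volume) :=
  (integrable_scaledBound d).mono' (measurable_limitIntegrand hψ d k).aestronglyMeasurable
    (Eventually.of_forall fun x => norm_limitIntegrand_le hψ hd hk x.1 x.2)

theorem integrable_scaledIntegrand {ψ : ℝ → ℝ} (hψ : IsDyadicPartition ψ) {d k : ℕ} (hd : 2 ≤ d)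
    (hk : 1 ≤ k) {ε₀ ε : ℝ} (hε₀ : 0 < ε₀) (hε₀' : ε₀ ≤ 1 / 32) (hε : 0 < ε) (hε' : ε ≤ 1 / 4) :
    Integrable (Function.uncurry (scaledIntegrand d k ψ ε₀ ε)) (volume.prod volume) :=
  (integrable_scaledBound d).mono' (measurable_scaledIntegrand hψ d k ε₀ ε).aestronglyMeasurable
    (Eventually.of_forall fun x => norm_scaledIntegrand_le hψ hd hk hε₀ hε₀' hε hε' x.1 x.2)

theorem tendsto_integral_scaledIntegrand {ψ : ℝ → ℝ} (hψ : IsDyadicPartition ψ) {d k : ℕ} (hd : 2 ≤ d)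
    (hk : 1 ≤ k) {ε₀ : ℝ} (hε₀ : 0 < ε₀) (hε₀' : ε₀ ≤ 1 / 32) :
    Tendsto (fun ε => ∫ r, ∫ u, scaledIntegrand d k ψ ε₀ ε r u) (𝓝[>] 0)
      (𝓝 (∫ r, ∫ u, limitIntegrand d k ψ r u)) := by
  have hmem : Ioc (0 : ℝ) (1 / 4) ∈ 𝓝[>] (0 : ℝ) := Ioc_mem_nhdsGT (by norm_num)
  have h := tendsto_integral_filter_of_dominated_convergence (μ := (volume : Measure ℝ).prod volume)
    (F := fun ε => Function.uncurry (scaledIntegrand d k ψ ε₀ ε)) (l := 𝓝[>] (0 : ℝ))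
    (f := Function.uncurry (limitIntegrand d k ψ))
    (Function.uncurry (scaledBound d))
    (Eventually.of_forall fun ε => (measurable_scaledIntegrand hψ d k ε₀ ε).aestronglyMeasurable)
    (by
      filter_upwards [hmem] with ε hε
      exact Eventually.of_forall fun x =>
        norm_scaledIntegrand_le hψ hd hk hε₀ hε₀' hε.1 hε.2 x.1 x.2)
    (integrable_scaledBound d)
    (Eventually.of_forall fun x => tendsto_scaledIntegrand hψ d k ε₀ x.1 x.2)
  rw [integral_prod _ (integrable_limitIntegrand hψ hd hk)] at h
  refine h.congr' ?_
  filter_upwards [hmem] with ε hε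
  exact integral_prod _ (integrable_scaledIntegrand hψ hd hk hε₀ hε₀' hε.1 hε.2)

theorem integral_norm_scaledIntegrand_le {ψ : ℝ → ℝ} (hψ : IsDyadicPartition ψ) {d k : ℕ}
    (hd : 2 ≤ d) (hk : 1 ≤ k) {ε₀ ε : ℝ} (hε₀ : 0 < ε₀) (hε₀' : ε₀ ≤ 1 / 32) (hε : 0 < ε)
    (hε' : ε ≤ 1 / 4) :
    ∫ r, ∫ u, ‖scaledIntegrand d k ψ ε₀ ε r u‖ ≤
      ∫ x, Function.uncurry (scaledBound d) x ∂((volume : Measure ℝ).prod volume) := by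
  have h1 := (integrable_scaledIntegrand hψ hd hk hε₀ hε₀' hε hε').norm
  have h2 := integral_prod _ h1
  refine (h2.symm.trans_le ?_)
  exact integral_mono h1 (integrable_scaledBound d)
    fun x => norm_scaledIntegrand_le hψ hd hk hε₀ hε₀' hε hε' x.1 x.2

theorem integral_limitIntegrand_ne_zero {ψ : ℝ → ℝ} (hψ : IsDyadicPartition ψ) {d k : ℕ} (hd : 2 ≤ d)
    (hk : 1 ≤ k) : ∫ r, ∫ u, limitIntegrand d k ψ r u ≠ 0 := by
  have hα : (1 : ℝ) ≤ (d : ℝ) / 2 := by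
    have : (2 : ℝ) ≤ d := by exact_mod_cast hd
    linarith
  obtain ⟨κ, hκ, hneg⟩ := exists_integral_cpow_mul_pow_of_neg hα hk
  have hint := integrable_limitIntegrand hψ hd hk
  rw [integral_integral_swap hint]
  -- Writing `min u 0` for `u` keeps the base `1 - min u 0` positive for every `u`, without changing
  -- it on the half-line that matters.
  set p : ℝ → ℝ := fun u => ψ u * Real.exp (-u ^ 2 / 2) *
    (1 - min u 0) ^ (-((d : ℝ) / 2 + k - 1)) with hp
  have hu : ∀ u : ℝ, ∫ r, limitIntegrand d k ψ r u =
      κ * (((Iio (0 : ℝ)).indicator p u : ℝ) : ℂ) := by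
    intro u
    unfold limitIntegrand
    rw [integral_const_mul]
    rcases lt_trichotomy u 0 with h | h | h
    · rw [hneg u h, indicator_of_mem (mem_Iio.2 h)]
      simp only [hp, min_eq_left h.le]
      push_cast
      ring
    · rw [h, partition_zero hψ]
      simp
    · rw [integral_cpow_mul_pow_of_pos hα hk h, indicator_of_notMem (by simpa using h.le)]
      simp
  have hpI : Integrable ((Iio (0 : ℝ)).indicator p) := by
    have h1 : Integrable (fun u => κ * (((Iio (0 : ℝ)).indicator p u : ℝ) : ℂ)) := by
      simp_rw [← hu]
      exact hint.integral_prod_right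
    have h2 : Integrable (fun u => (((Iio (0 : ℝ)).indicator p u : ℝ) : ℂ)) := by
      simpa [← mul_assoc, inv_mul_cancel₀ hκ] using h1.const_mul κ⁻¹
    simpa using h2.re
  simp_rw [hu]
  rw [integral_const_mul, integral_complex_ofReal]
  refine mul_ne_zero hκ (Complex.ofReal_ne_zero.2 (ne_of_gt ?_))
  have hp0 : ∀ u, 0 ≤ p u := fun u =>
    mul_nonneg (mul_nonneg (hψ.nonneg u) (Real.exp_pos _).le)
      (Real.rpow_nonneg (by have := min_le_right u 0; linarith) _)
  rw [integral_pos_iff_support_of_nonneg (fun u => indicator_nonneg (fun v _ => hp0 v) u) hpI]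
  obtain ⟨t, ht, ht'⟩ := exists_neg_partition_ne_zero hψ
  have hopen : IsOpen (Function.support ψ ∩ Iio 0) :=
    (hψ.smooth.continuous.isOpen_support).inter isOpen_Iio
  refine (hopen.measure_pos volume ⟨t, ht', ht⟩).trans_le (measure_mono ?_)
  rintro u ⟨h1, h2⟩
  rw [Function.mem_support, indicator_of_mem h2]
  have h3 : 0 < 1 - min u 0 := by have := min_le_right u 0; linarith
  exact mul_ne_zero (mul_ne_zero h1 (Real.exp_pos _).ne') (Real.rpow_pos_of_pos h3 _).ne'

/-! ### The focusing wave: size, Fourier transform and action of the multiplier -/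

/-- The focusing wave `exp (-(ε + i)|y|) exp (-(ε t)² / 2)`. -/
noncomputable def focusingWave (d : ℕ) (ε : ℝ) (x : EucProd d) : ℂ :=
  Complex.exp (-(((ε : ℂ) + Complex.I) * ‖x.1‖)) * (Real.exp (-(ε * x.2) ^ 2 / 2) : ℂ)

theorem norm_focusingWave (d : ℕ) (ε : ℝ) (x : EucProd d) :
    ‖focusingWave d ε x‖ = Real.exp (-(ε * ‖x.1‖)) * Real.exp (-(ε * x.2) ^ 2 / 2) := by
  rw [focusingWave, norm_mul, Complex.norm_exp, Complex.norm_real,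
    Real.norm_of_nonneg (Real.exp_pos _).le]
  congr 2
  simp

theorem norm_focusingWave_le_one {d : ℕ} {ε : ℝ} (hε : 0 < ε) (x : EucProd d) :
    ‖focusingWave d ε x‖ ≤ 1 := by
  rw [norm_focusingWave]
  refine mul_le_one₀ (Real.exp_le_one_iff.2 ?_) (Real.exp_pos _).le (Real.exp_le_one_iff.2 ?_)
  · have : 0 ≤ ε * ‖x.1‖ := by positivity
    linarith
  · have := sq_nonneg (ε * x.2)
    linarith

theorem continuous_focusingWave (d : ℕ) (ε : ℝ) : Continuous (focusingWave d ε) := by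
  unfold focusingWave
  fun_prop

theorem integrable_exp_neg_sq {ε : ℝ} (hε : 0 < ε) :
    Integrable (fun t : ℝ => Real.exp (-(ε * t) ^ 2 / 2)) := by
  have := integrable_exp_neg_mul_sq (b := ε ^ 2 / 2) (by positivity)
  refine this.congr (Eventually.of_forall fun t => ?_)
  simp only
  ring_nf

theorem integral_exp_neg_sq {ε : ℝ} (hε : 0 < ε) :
    ∫ t : ℝ, Real.exp (-(ε * t) ^ 2 / 2) = Real.sqrt (2 * Real.pi) / ε := by
  have := integral_gaussian (ε ^ 2 / 2)
  have e : Real.pi / (ε ^ 2 / 2) = 2 * Real.pi / ε ^ 2 := by field_simp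
  rw [e, Real.sqrt_div (by positivity), Real.sqrt_sq hε.le] at this
  rw [← this]
  congr 1
  ext t
  ring_nf

theorem integrable_focusingWave {d : ℕ} {ε : ℝ} (hε : 0 < ε) : Integrable (focusingWave d ε) := by
  have h1 := (integrable_exp_neg_norm (volume : Measure (EuclideanSpace ℝ (Fin (d - 1)))) hε).mul_prod
    (integrable_exp_neg_sq hε)
  refine h1.mono' (continuous_focusingWave d ε).aestronglyMeasurable
    (Eventually.of_forall fun x => (norm_focusingWave d ε x).le)

theorem exists_lintegral_focusingWave_le {d : ℕ} (hd : 1 ≤ d) :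
    ∃ C : ℝ, 1 ≤ C ∧ ∀ ε : ℝ, 0 < ε →
      ∫⁻ x, ‖focusingWave d ε x‖ₑ ≤ ENNReal.ofReal (C * ε ^ (-(d : ℝ))) := by
  set A := ∫ y : EuclideanSpace ℝ (Fin (d - 1)), Real.exp (-‖y‖) with hA
  refine ⟨max 1 (A * Real.sqrt (2 * Real.pi)), le_max_left _ _, fun ε hε => ?_⟩
  rw [← ofReal_integral_norm_eq_lintegral_enorm (integrable_focusingWave hε)]
  refine ENNReal.ofReal_le_ofReal ?_
  simp_rw [norm_focusingWave]
  have h1 : ∫ x : EucProd d, Real.exp (-(ε * ‖x.1‖)) * Real.exp (-(ε * x.2) ^ 2 / 2) =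
      (∫ y : EuclideanSpace ℝ (Fin (d - 1)), Real.exp (-(ε * ‖y‖))) *
        ∫ t : ℝ, Real.exp (-(ε * t) ^ 2 / 2) :=
    integral_prod_mul (fun y : EuclideanSpace ℝ (Fin (d - 1)) => Real.exp (-(ε * ‖y‖)))
      (fun t : ℝ => Real.exp (-(ε * t) ^ 2 / 2))
  have h2 : ∫ y : EuclideanSpace ℝ (Fin (d - 1)), Real.exp (-(ε * ‖y‖)) = (ε ^ (d - 1))⁻¹ * A := by
    have := Measure.integral_comp_smul_of_nonneg
      (volume : Measure (EuclideanSpace ℝ (Fin (d - 1)))) (fun y => Real.exp (-‖y‖)) ε (hR := hε.le)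
    simp only [norm_smul, Real.norm_of_nonneg hε.le, finrank_euclideanSpace_fin, smul_eq_mul] at this
    exact this
  rw [h1, h2, integral_exp_neg_sq hε]
  have h3 : ε ^ (-(d : ℝ)) = (ε ^ (d - 1))⁻¹ * ε⁻¹ := by
    rw [Real.rpow_neg hε.le, Real.rpow_natCast, ← mul_inv, ← pow_succ]
    congr 3
    omega
  calc (ε ^ (d - 1))⁻¹ * A * (Real.sqrt (2 * Real.pi) / ε)
      = (A * Real.sqrt (2 * Real.pi)) * ε ^ (-(d : ℝ)) := by rw [h3]; ring
    _ ≤ _ := by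
        gcongr
        exact le_max_right _ _

theorem exists_fourierT_focusingWave {d : ℕ} (hd : 1 ≤ d) :
    ∃ C : ℝ, 0 < C ∧ ∀ ε : ℝ, 0 < ε → ∀ ξ : EucProd d, fourierT (focusingWave d ε) ξ =
      (C : ℂ) * (((ε : ℂ) + Complex.I) * (((ε : ℂ) + Complex.I) ^ 2 + (‖ξ.1‖ : ℂ) ^ 2) ^
        (-(((d : ℝ) / 2 : ℝ) : ℂ))) * ((ε⁻¹ * Real.exp (-(ε⁻¹ * ξ.2) ^ 2 / 2) : ℝ) : ℂ) := by
  obtain ⟨C, hC, hP⟩ := exists_integral_exp_neg_mul_norm (EuclideanSpace ℝ (Fin (d - 1)))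
  refine ⟨C * Real.sqrt (2 * Real.pi), by positivity, fun ε hε ξ => ?_⟩
  have h1 : fourierT (focusingWave d ε) ξ =
      (∫ y : EuclideanSpace ℝ (Fin (d - 1)), Complex.exp (-(((ε : ℂ) + Complex.I) * ‖y‖)) *
        Complex.exp (-(Complex.I * (inner ℝ y ξ.1 : ℝ)))) *
      ∫ t : ℝ, Complex.exp (Complex.I * (-ξ.2 : ℂ) * t) *
        Complex.exp (-((ε ^ 2 / 2 : ℝ) : ℂ) * (t : ℂ) ^ 2) := by
    refine Eq.trans ?_ (integral_prod_mul _ _)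
    unfold fourierT
    congr 1
    ext x
    rw [focusingWave, eucDot]
    push_cast
    have e : -(Complex.I * (((inner ℝ x.1 ξ.1 : ℝ) : ℂ) + (x.2 : ℂ) * (ξ.2 : ℂ))) =
        -(Complex.I * ((inner ℝ x.1 ξ.1 : ℝ) : ℂ)) + Complex.I * (-ξ.2 : ℂ) * x.2 := by ring
    have e2 : (-((ε : ℂ) * (x.2 : ℂ)) ^ 2 / 2) = -((ε : ℂ) ^ 2 / 2) * (x.2 : ℂ) ^ 2 := by ring
    rw [e, Complex.exp_add, e2]
    ring
  have hb : 0 < ((ε ^ 2 / 2 : ℝ) : ℂ).re := by rw [Complex.ofReal_re]; positivity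
  rw [h1, fourierIntegral_gaussian hb, hP ξ.1 ((ε : ℂ) + Complex.I) (by simpa using hε)]
  have h2 : (((Module.finrank ℝ (EuclideanSpace ℝ (Fin (d - 1))) : ℝ) + 1) / 2 : ℝ) = (d : ℝ) / 2 := by
    rw [finrank_euclideanSpace_fin]
    push_cast [hd]
    ring
  have h3 : ((Real.pi : ℂ) / ((ε ^ 2 / 2 : ℝ) : ℂ)) ^ (1 / 2 : ℂ) =
      ((Real.sqrt (2 * Real.pi) / ε : ℝ) : ℂ) := by
    have e : Real.pi / (ε ^ 2 / 2) = 2 * Real.pi / ε ^ 2 := by field_simp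
    rw [← Real.sqrt_sq hε.le, ← Real.sqrt_div (by positivity), Real.sqrt_sq hε.le, ← e,
      Real.sqrt_eq_rpow, Complex.ofReal_cpow (by positivity)]
    push_cast
    rfl
  have h4 : (-(-ξ.2 : ℂ) ^ 2 / (4 * ((ε ^ 2 / 2 : ℝ) : ℂ))) = ((-(ε⁻¹ * ξ.2) ^ 2 / 2 : ℝ) : ℂ) := by
    have : (ε : ℂ) ≠ 0 := by exact_mod_cast hε.ne'
    push_cast
    field_simp
    ring
  rw [h2, h3, h4]
  push_cast
  ring

theorem ofReal_mul_cpow {a : ℝ} (ha : 0 < a) {z : ℂ} (hz : z ≠ 0) (b : ℝ) :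
    ((a : ℂ) * z) ^ (b : ℂ) = ((a ^ b : ℝ) : ℂ) * z ^ (b : ℂ) := by
  have ha' : (a : ℂ) ≠ 0 := by exact_mod_cast ha.ne'
  rw [Complex.cpow_def_of_ne_zero (mul_ne_zero ha' hz), Complex.log_ofReal_mul ha hz,
    Complex.ofReal_cpow ha.le, Complex.cpow_def_of_ne_zero ha', Complex.cpow_def_of_ne_zero hz,
    ← Complex.exp_add, Complex.ofReal_log ha.le]
  ring_nf

theorem integrable_mEps_mul_fourierT {d k : ℕ} (hd : 1 ≤ d) {ψ : ℝ → ℝ} (hψ : IsDyadicPartition ψ)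
    {ε₀ ε : ℝ} (hε₀ : 0 < ε₀) (hε₀' : ε₀ ≤ 1 / 32) (hε : 0 < ε) :
    Integrable (fun ξ => mEps d k ψ ε₀ ε ξ * fourierT (focusingWave d ε) ξ) := by
  obtain ⟨C, -, hC⟩ := exists_fourierT_focusingWave hd
  have hm : Measurable (fourierT (focusingWave d ε)) := by
    rw [funext (hC ε hε)]
    fun_prop
  refine (integrable_mEps hψ hε₀ hε₀' hε).mul_bdd (c := ∫ x, ‖focusingWave d ε x‖)
    hm.aestronglyMeasurable (Eventually.of_forall fun ξ => ?_)
  refine (norm_integral_le_integral_norm _).trans_eq ?_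
  congr 1
  ext x
  rw [norm_mul, Complex.norm_exp]
  simp

/-- The multiplier integrals of the focusing wave at the origin, in rescaled variables. -/
theorem exists_integral_mEps_mul_fourierT {d k : ℕ} (hd : 2 ≤ d) {ψ : ℝ → ℝ}
    (hψ : IsDyadicPartition ψ) {ε₀ : ℝ} (hε₀ : 0 < ε₀) (hε₀' : ε₀ ≤ 1 / 32) :
    ∃ K : ℝ, 0 < K ∧ ∀ ε : ℝ, 0 < ε →
      (∫ ξ, mEps d k ψ ε₀ ε ξ * fourierT (focusingWave d ε) ξ =
        ((K * ε ^ (-(((d : ℝ) - 2 + 2 * k) / 2)) : ℝ) : ℂ) * ((ε : ℂ) + Complex.I) *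
          ∫ r, ∫ u, scaledIntegrand d k ψ ε₀ ε r u) ∧
      ∫ ξ, ‖mEps d k ψ ε₀ ε ξ * fourierT (focusingWave d ε) ξ‖ =
        K * ε ^ (-(((d : ℝ) - 2 + 2 * k) / 2)) * ‖(ε : ℂ) + Complex.I‖ *
          ∫ r, ∫ u, ‖scaledIntegrand d k ψ ε₀ ε r u‖ := by
  obtain ⟨C, hC0, hC⟩ := exists_fourierT_focusingWave (d := d) (by omega)
  set V : ℝ := ((d - 1 : ℕ) : ℝ) *
    volume.real (Metric.ball (0 : EuclideanSpace ℝ (Fin (d - 1))) 1) with hV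
  have hV0 : 0 < V := by
    have h1 : 0 < ((d - 1 : ℕ) : ℝ) := by exact_mod_cast (by omega : 0 < d - 1)
    have h2 : 0 < volume.real (Metric.ball (0 : EuclideanSpace ℝ (Fin (d - 1))) 1) :=
      ENNReal.toReal_pos (Metric.measure_ball_pos _ _ one_pos).ne' measure_ball_lt_top.ne
    positivity
  refine ⟨V * C, by positivity, fun ε hε => ?_⟩
  set α : ℝ := (d : ℝ) / 2 with hα
  set F : ℝ → ℝ → ℂ := fun ρ τ =>
    ((lowPart ψ (ε₀⁻¹ * (1 - ρ ^ 2)) * ψ (ε⁻¹ * τ) : ℝ) : ℂ) /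
      (((ρ ^ 2 - 1 + τ ^ 2 : ℝ) : ℂ) + 2 * Complex.I * (τ : ℂ)) ^ k *
    ((C : ℂ) * (((ε : ℂ) + Complex.I) * (((ε : ℂ) + Complex.I) ^ 2 + (ρ : ℂ) ^ 2) ^ (-(α : ℂ))) *
      ((ε⁻¹ * Real.exp (-(ε⁻¹ * τ) ^ 2 / 2) : ℝ) : ℂ)) with hF
  have hmF : (fun ξ => mEps d k ψ ε₀ ε ξ * fourierT (focusingWave d ε) ξ) =
      fun ξ : EucProd d => F ‖ξ.1‖ ξ.2 := by
    ext ξ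
    rw [hC ε hε]
    rfl
  have hFi : Integrable (fun ξ : EucProd d => F ‖ξ.1‖ ξ.2) := by
    rw [← hmF]
    exact integrable_mEps_mul_fourierT (by omega) hψ hε₀ hε₀' hε
  set A : ℂ := ((C * ε ^ (-1 - α - k) : ℝ) : ℂ) * ((ε : ℂ) + Complex.I) with hA
  have hnorm : ‖A‖ = C * ε ^ (-1 - α - k) * ‖(ε : ℂ) + Complex.I‖ := by
    rw [hA, norm_mul, Complex.norm_real, Real.norm_of_nonneg (by positivity)]
  -- The Jacobian contributes `ε²`, the Gaussian `ε^(-1)`, the Poisson kernel `ε^(-d/2)` and the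
  -- denominator of the multiplier `ε^(-k)`.
  have hpow : ε ^ 2 * ε ^ (-1 - α - k) = ε ^ (-(((d : ℝ) - 2 + 2 * k) / 2)) := by
    rw [← Real.rpow_two, ← Real.rpow_add hε, hα]
    ring_nf
  have hkey : ∀ r u : ℝ, (if 0 < 1 + ε * r then (1 + ε * r) ^ (d - 2) else 0 : ℝ) •
      F (1 + ε * r) (ε * u) = A * scaledIntegrand d k ψ ε₀ ε r u := by
    intro r u
    have hε' : (ε : ℂ) ≠ 0 := by exact_mod_cast hε.ne'
    set z₁ : ℂ := ((r * (2 + ε * r) + ε : ℝ) : ℂ) + 2 * Complex.I with hz₁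
    set z₂ : ℂ := ((r * (2 + ε * r) + ε * u ^ 2 : ℝ) : ℂ) + 2 * Complex.I * u with hz₂
    have hz₁0 : z₁ ≠ 0 := by
      intro h
      have := congrArg Complex.im h
      rw [hz₁, Complex.add_im, Complex.ofReal_im] at this
      simp at this
    -- The frequency `1` of the wave cancels the radius `1` of the sphere: `(ε + i)² + 1 = ε² +
    -- 2iε`, so a factor `ε` comes out.
    have e1 : ((ε : ℂ) + Complex.I) ^ 2 + ((1 + ε * r : ℝ) : ℂ) ^ 2 = (ε : ℂ) * z₁ := by
      rw [hz₁]
      push_cast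
      linear_combination Complex.I_sq
    have e2 : ((((1 + ε * r) ^ 2 - 1 + (ε * u) ^ 2 : ℝ) : ℂ) + 2 * Complex.I * ((ε * u : ℝ) : ℂ)) =
        (ε : ℂ) * z₂ := by
      rw [hz₂]
      push_cast
      ring
    have e3 : ε⁻¹ * (ε * u) = u := by field_simp
    have e4 : ε ^ (-1 - α - k) = ε⁻¹ * ε ^ (-α) * (ε ^ k)⁻¹ := by
      rw [← Real.rpow_neg_one, ← Real.rpow_natCast, ← Real.rpow_neg hε.le, ← Real.rpow_add hε,
        ← Real.rpow_add hε]
      ring_nf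
    simp only [hF]
    rw [e1, e2, e3, ← Complex.ofReal_neg, ofReal_mul_cpow hε hz₁0, mul_pow, scaledIntegrand, scaledWeight,
      ← hz₁, ← hz₂, ← hα, hA, e4, Complex.real_smul, Complex.ofReal_neg]
    push_cast
    ring
  constructor
  · rw [hmF, integral_radial_rescale hd hFi hε, ← hV]
    simp_rw [hkey, integral_const_mul]
    rw [Complex.real_smul, hA, ← hpow]
    push_cast
    ring
  · have h1 : ∫ ξ, ‖mEps d k ψ ε₀ ε ξ * fourierT (focusingWave d ε) ξ‖ =
        ∫ ξ : EucProd d, (fun ρ τ => ‖F ρ τ‖) ‖ξ.1‖ ξ.2 :=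
      congrArg (fun G : EucProd d → ℂ => ∫ ξ, ‖G ξ‖) hmF
    rw [h1, integral_radial_rescale (F := fun ρ τ => ‖F ρ τ‖) hd hFi.norm hε, ← hV]
    have h2 : ∀ r u : ℝ, (if 0 < 1 + ε * r then (1 + ε * r) ^ (d - 2) else 0 : ℝ) •
        ‖F (1 + ε * r) (ε * u)‖ = ‖A‖ * ‖scaledIntegrand d k ψ ε₀ ε r u‖ := by
      intro r u
      rw [← norm_mul, ← hkey, norm_smul, smul_eq_mul]
      congr 1
      rw [Real.norm_of_nonneg]
      split_ifs with h
      · positivity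
      · exact le_rfl
    simp_rw [h2, integral_const_mul]
    rw [hnorm, smul_eq_mul, ← hpow]
    ring

/-- The absolute integral has the same order as the integral itself, so a phase varying by a small
constant independent of `ε` cannot destroy the lower bound. -/
theorem exists_bounds_mEps_mul_fourierT {d k : ℕ} (hd : 2 ≤ d) (hk : 1 ≤ k) {ψ : ℝ → ℝ}
    (hψ : IsDyadicPartition ψ) {ε₀ : ℝ} (hε₀ : 0 < ε₀) (hε₀' : ε₀ ≤ 1 / 32) :
    ∃ w : ℝ, 0 < w ∧ ∃ B : ℝ, 0 < B ∧ ∃ δ : ℝ, 0 < δ ∧ ∀ ε : ℝ, 0 < ε → ε ≤ δ →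
      w * ε ^ (-(((d : ℝ) - 2 + 2 * k) / 2)) ≤
        ‖∫ ξ, mEps d k ψ ε₀ ε ξ * fourierT (focusingWave d ε) ξ‖ ∧
      ∫ ξ, ‖mEps d k ψ ε₀ ε ξ * fourierT (focusingWave d ε) ξ‖ ≤
        B * ε ^ (-(((d : ℝ) - 2 + 2 * k) / 2)) := by
  obtain ⟨K, hK, hint⟩ := exists_integral_mEps_mul_fourierT (k := k) hd hψ hε₀ hε₀'
  set L := ∫ r, ∫ u, limitIntegrand d k ψ r u with hL
  have hL0 : 0 < ‖L‖ := norm_pos_iff.2 (integral_limitIntegrand_ne_zero hψ hd hk)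
  set B := ∫ x, Function.uncurry (scaledBound d) x ∂((volume : Measure ℝ).prod volume) with hB
  have hB0 : 0 ≤ B := by
    have h1 := integral_norm_scaledIntegrand_le (k := k) hψ hd hk hε₀ hε₀' (ε := 1 / 4) (by norm_num) le_rfl
    refine le_trans ?_ h1
    exact integral_nonneg fun r => integral_nonneg fun u => norm_nonneg _
  have ht := (tendsto_integral_scaledIntegrand hψ hd hk hε₀ hε₀').norm
  have hev := ht.eventually (lt_mem_nhds (by linarith : ‖L‖ / 2 < ‖L‖))
  obtain ⟨δ, hδ, hδ'⟩ := mem_nhdsGT_iff_exists_Ioc_subset.1 hev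
  have hδ0 : 0 < δ := hδ
  refine ⟨K * (‖L‖ / 2), by positivity, K * 2 * (B + 1), by positivity, min δ (1 / 4),
    lt_min hδ0 (by norm_num), fun ε hε hεδ => ?_⟩
  obtain ⟨h1, h2⟩ := hint ε hε
  have hε4 : ε ≤ 1 / 4 := hεδ.trans (min_le_right _ _)
  have h3 : ‖L‖ / 2 < ‖∫ r, ∫ u, scaledIntegrand d k ψ ε₀ ε r u‖ :=
    hδ' ⟨hε, hεδ.trans (min_le_left _ _)⟩
  have hs1 : 1 ≤ ‖(ε : ℂ) + Complex.I‖ := by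
    have := Complex.abs_im_le_norm ((ε : ℂ) + Complex.I)
    simpa using this
  have hs2 : ‖(ε : ℂ) + Complex.I‖ ≤ 2 := by
    refine (norm_add_le _ _).trans ?_
    rw [Complex.norm_real, Real.norm_of_nonneg hε.le, Complex.norm_I]
    linarith
  set P := ε ^ (-(((d : ℝ) - 2 + 2 * k) / 2)) with hP
  have hP0 : 0 < P := Real.rpow_pos_of_pos hε _
  constructor
  · rw [h1, norm_mul, norm_mul, Complex.norm_real, Real.norm_of_nonneg (by positivity)]
    calc K * (‖L‖ / 2) * P = K * P * 1 * (‖L‖ / 2) := by ring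
      _ ≤ _ := by gcongr
  · rw [h2]
    have h4 := integral_norm_scaledIntegrand_le (k := k) hψ hd hk hε₀ hε₀' hε hε4
    calc _ ≤ K * P * 2 * (B + 1) := by
          gcongr
          linarith
      _ = _ := by ring

/-! ### Schwartz approximation and tools for testing operator norms -/

theorem exists_schwartz_approx_focusingWave (d : ℕ) {ε : ℝ} (hε : 0 < ε) :
    ∃ f : ℕ → 𝓢(EucProd d, ℂ), (∀ N x, ‖f N x‖ ≤ ‖focusingWave d ε x‖) ∧
      (∀ x, Tendsto (fun N => f N x) atTop (𝓝 (focusingWave d ε x))) ∧ ∀ N, f N 0 ≠ 0 := by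
  set b : (N : ℕ) → ContDiffBump (0 : EucProd d) := fun N =>
    { rIn := N + 1, rOut := N + 2, rIn_pos := by positivity, rIn_lt_rOut := by linarith } with hb
  -- This smooths the singularity of `‖y‖` at `0` from above; since `ρ ≥ ‖y‖`, the damping only
  -- increases and the approximations stay below the wave.
  set ρ : ℕ → EucProd d → ℝ := fun N x => Real.sqrt (‖x.1‖ ^ 2 + (1 / ((N : ℝ) + 1)) ^ 2) with hρ
  set g : ℕ → EucProd d → ℂ := fun N x => ((b N x : ℝ) : ℂ) *
    (Complex.exp (-(((ε : ℂ) + Complex.I) * (ρ N x : ℝ))) * (Real.exp (-(ε * x.2) ^ 2 / 2) : ℂ)) with hg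
  have hρs : ∀ N, ContDiff ℝ ∞ (ρ N) := by
    intro N
    refine ContDiff.sqrt ((contDiff_fst.norm_sq ℝ).add contDiff_const) fun x => ?_
    positivity
  have hofReal : ContDiff ℝ ∞ (fun t : ℝ => (t : ℂ)) := Complex.ofRealCLM.contDiff
  have hgs : ∀ N, ContDiff ℝ ∞ (g N) := by
    intro N
    have h1 : ContDiff ℝ ∞ (fun x : EucProd d => -(((ε : ℂ) + Complex.I) * (ρ N x : ℝ))) :=
      (contDiff_const.mul (hofReal.comp (hρs N))).neg
    have h2 : ContDiff ℝ ∞ (fun x : EucProd d => Real.exp (-(ε * x.2) ^ 2 / 2)) := by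
      have : ContDiff ℝ ∞ (fun x : EucProd d => ε * x.2) := contDiff_const.mul contDiff_snd
      exact ((this.pow 2).neg.div_const 2).exp
    exact (hofReal.comp (b N).contDiff).mul (h1.cexp.mul (hofReal.comp h2))
  have hgc : ∀ N, HasCompactSupport (g N) := by
    intro N
    refine HasCompactSupport.mul_right ?_
    exact (b N).hasCompactSupport.comp_left (g := fun t : ℝ => (t : ℂ)) Complex.ofReal_zero
  have hgf : ∀ N x, (hgc N).toSchwartzMap (hgs N) x = g N x := fun N x => rfl
  refine ⟨fun N => (hgc N).toSchwartzMap (hgs N), fun N x => ?_, fun x => ?_, fun N => ?_⟩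
  · rw [hgf, hg, norm_mul, norm_focusingWave, norm_mul, Complex.norm_real, Complex.norm_real,
      Real.norm_of_nonneg (b N).nonneg, Real.norm_of_nonneg (Real.exp_pos _).le, Complex.norm_exp]
    have h1 : (-(((ε : ℂ) + Complex.I) * (ρ N x : ℝ))).re = -(ε * ρ N x) := by simp
    have h2 : ‖x.1‖ ≤ ρ N x := by
      refine Real.le_sqrt_of_sq_le ?_
      have : 0 ≤ (1 / ((N : ℝ) + 1)) ^ 2 := by positivity
      linarith
    rw [h1]
    calc _ ≤ 1 * (Real.exp (-(ε * ρ N x)) * Real.exp (-(ε * x.2) ^ 2 / 2)) := by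
          gcongr
          exact (b N).le_one
      _ ≤ _ := by
          rw [one_mul]
          gcongr
  · simp only [hgf]
    have h1 : Tendsto (fun N => ρ N x) atTop (𝓝 ‖x.1‖) := by
      have h2 : Tendsto (fun N : ℕ => ‖x.1‖ ^ 2 + (1 / ((N : ℝ) + 1)) ^ 2) atTop
          (𝓝 (‖x.1‖ ^ 2 + 0 ^ 2)) :=
        tendsto_const_nhds.add (tendsto_one_div_add_atTop_nhds_zero_nat.pow 2)
      have h3 := (Real.continuous_sqrt.tendsto _).comp h2
      simp only [ne_eq, OfNat.ofNat_ne_zero, not_false_eq_true, zero_pow, add_zero,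
        Real.sqrt_sq (norm_nonneg _)] at h3
      exact h3
    have h2 : Tendsto (fun N => ((b N x : ℝ) : ℂ)) atTop (𝓝 1) := by
      refine tendsto_const_nhds.congr' ?_
      obtain ⟨M, hM⟩ := exists_nat_ge ‖x‖
      filter_upwards [eventually_ge_atTop M] with N hN
      have hN' : (M : ℝ) ≤ N := by exact_mod_cast hN
      rw [(b N).one_of_mem_closedBall, Complex.ofReal_one]
      rw [mem_closedBall_zero_iff]
      change ‖x‖ ≤ (N : ℝ) + 1
      linarith
    have h3 : Continuous (fun t : ℝ => Complex.exp (-(((ε : ℂ) + Complex.I) * (t : ℝ))) *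
      (Real.exp (-(ε * x.2) ^ 2 / 2) : ℂ)) := by fun_prop
    have h4 := h2.mul ((h3.tendsto _).comp h1)
    rw [one_mul] at h4
    exact h4
  · have h1 : b N 0 = 1 := (b N).one_of_mem_closedBall (by
      rw [mem_closedBall_zero_iff, norm_zero]
      exact (b N).rIn_pos.le)
    simp only [hgf, hg, h1]
    simp [Complex.exp_ne_zero]

theorem multiplierOp_smul {d : ℕ} (m : EucProd d → ℂ) (c : ℂ) (f : 𝓢(EucProd d, ℂ)) :
    multiplierOp m (c • f) = c • multiplierOp m f := by
  have h : ∀ ξ, fourierT (fun x => (c • f) x) ξ = c * fourierT (fun x => f x) ξ := by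
    intro ξ
    unfold fourierT
    rw [← integral_const_mul]
    congr 1
    ext x
    simp only [smul_apply, smul_eq_mul]
    ring
  ext x
  simp only [multiplierOp, h, Pi.smul_apply, smul_eq_mul, invFourierT]
  rw [mul_left_comm, ← integral_const_mul c]
  congr 2
  ext ξ
  ring

theorem le_pqNorm {d : ℕ} (m : EucProd d → ℂ) {p q : ℝ≥0∞} (f : 𝓢(EucProd d, ℂ))
    (h0 : eLpNorm (fun x => f x) p volume ≠ 0) (h1 : eLpNorm (fun x => f x) p volume ≠ ⊤) :
    eLpNorm (multiplierOp m f) q volume / eLpNorm (fun x => f x) p volume ≤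
      pqNorm (multiplierOp m) p q := by
  set a := eLpNorm (fun x => f x) p volume with ha
  set c : ℂ := (((a.toReal)⁻¹ : ℝ) : ℂ) with hc
  have hcn : ‖c‖ₑ = a⁻¹ := by
    have hpos := ENNReal.toReal_pos h0 h1
    rw [← ofReal_norm, hc, Complex.norm_real, Real.norm_of_nonneg (by positivity),
      ENNReal.ofReal_inv_of_pos hpos, ENNReal.ofReal_toReal h1]
  have h2 : eLpNorm (fun x => (c • f) x) p volume = 1 := by
    have : (fun x => (c • f) x) = c • (fun x => f x) := rfl
    rw [this, eLpNorm_const_smul, hcn, ← ha, ENNReal.inv_mul_cancel h0 h1]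
  have h3 : eLpNorm (multiplierOp m (c • f)) q volume =
      eLpNorm (multiplierOp m f) q volume / a := by
    rw [multiplierOp_smul, eLpNorm_const_smul, hcn, ENNReal.div_eq_inv_mul]
  rw [← h3]
  unfold pqNorm
  exact le_iSup₂ (f := fun (f : 𝓢(EucProd d, ℂ)) (_ : eLpNorm (fun x => f x) p volume = 1) =>
    eLpNorm (multiplierOp m f) q volume) (c • f) h2

/-- If `|f| ≤ 1` then `|f|^p ≤ |f|`, so the `L¹` bound controls every `p`; for `p = ∞` the exponent
is `0` and the bound is `1`. -/
theorem eLpNorm_le_lintegral_rpow {X : Type*} [MeasurableSpace X] {μ : Measure X} {f : X → ℂ}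
    {p : ℝ≥0∞} (hp : 1 ≤ p) (hf : ∀ x, ‖f x‖ ≤ 1) :
    eLpNorm f p μ ≤ (∫⁻ x, ‖f x‖ₑ ∂μ) ^ (p⁻¹).toReal := by
  by_cases hpt : p = ⊤
  · rw [hpt, ENNReal.inv_top, ENNReal.toReal_zero, ENNReal.rpow_zero]
    have := eLpNorm_le_of_ae_bound (μ := μ) (p := ⊤) (Eventually.of_forall hf)
    simpa using this
  · have hp0 : p ≠ 0 := (zero_lt_one.trans_le hp).ne'
    have hp1 : 1 ≤ p.toReal := by
      rw [← ENNReal.toReal_one]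
      exact ENNReal.toReal_mono hpt hp
    rw [eLpNorm_eq_lintegral_rpow_enorm_toReal hp0 hpt, ENNReal.toReal_inv, one_div]
    gcongr with x
    have h1 : ‖f x‖ₑ ≤ 1 := by
      rw [← ofReal_norm]
      exact ENNReal.ofReal_le_one.2 (hf x)
    calc ‖f x‖ₑ ^ p.toReal ≤ ‖f x‖ₑ ^ (1 : ℝ) := ENNReal.rpow_le_rpow_of_exponent_ge h1 hp1
      _ = _ := ENNReal.rpow_one _

theorem mul_rpow_le_eLpNorm {X : Type*} [MeasurableSpace X] {μ : Measure X} {f : X → ℂ}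
    {q : ℝ≥0∞} (hq : 1 ≤ q) {s : Set X} (hs : MeasurableSet s) (hs0 : μ s ≠ 0) {c : ℝ}
    (hc : 0 ≤ c) (hf : ∀ x ∈ s, c ≤ ‖f x‖) :
    ENNReal.ofReal c * μ s ^ (q⁻¹).toReal ≤ eLpNorm f q μ := by
  have h := eLpNorm_indicator_const' (c := c) (p := q) hs hs0 (zero_lt_one.trans_le hq).ne'
  rw [one_div, ← ENNReal.toReal_inv, Real.enorm_of_nonneg hc] at h
  rw [← h]
  refine eLpNorm_mono fun x => ?_
  by_cases hx : x ∈ s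
  · rw [indicator_of_mem hx, Real.norm_of_nonneg hc]
    exact hf x hx
  · rw [indicator_of_notMem hx, norm_zero]
    exact norm_nonneg _

theorem norm_fourierT_sub_le {d : ℕ} {f g : EucProd d → ℂ} (hf : Integrable f) (hg : Integrable g)
    (ξ : EucProd d) : ‖fourierT f ξ - fourierT g ξ‖ ≤ ∫ x, ‖f x - g x‖ := by
  have hc : Continuous (fun x : EucProd d => Complex.exp (-(Complex.I * (eucDot x ξ : ℂ)))) := by
    unfold eucDot
    fun_prop
  have hn : ∀ x : EucProd d, ‖Complex.exp (-(Complex.I * (eucDot x ξ : ℂ)))‖ = 1 := by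
    intro x
    rw [Complex.norm_exp]
    simp
  unfold fourierT
  rw [← integral_sub
    (hf.bdd_mul (c := 1) hc.aestronglyMeasurable (Eventually.of_forall fun x => (hn x).le))
    (hg.bdd_mul (c := 1) hc.aestronglyMeasurable (Eventually.of_forall fun x => (hn x).le))]
  refine (norm_integral_le_integral_norm _).trans_eq ?_
  congr 1
  ext x
  rw [← mul_sub, norm_mul, hn, one_mul]

theorem continuous_fourierT {d : ℕ} {f : EucProd d → ℂ} (hf : Integrable f) :
    Continuous (fourierT f) := by
  have hc : Continuous (fun z : EucProd d × EucProd d =>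
      Complex.exp (-(Complex.I * (eucDot z.1 z.2 : ℂ)))) := by
    unfold eucDot
    fun_prop
  have hn : ∀ x ξ : EucProd d, ‖Complex.exp (-(Complex.I * (eucDot x ξ : ℂ)))‖ = 1 := by
    intro x ξ
    rw [Complex.norm_exp]
    simp
  refine continuous_of_dominated (bound := fun x => ‖f x‖) (fun ξ => ?_)
    (fun ξ => Eventually.of_forall fun x => ?_) hf.norm (Eventually.of_forall fun x => ?_)
  · exact (hc.comp (continuous_id.prodMk continuous_const)).aestronglyMeasurable.mul hf.1
  · rw [norm_mul, hn, one_mul]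
  · exact (hc.comp (continuous_const.prodMk continuous_id)).mul continuous_const

/-! ### The lower bound for the operator norm -/

/-- Stability of the multiplier near the origin and under perturbation of the input. -/
theorem norm_invFourierT_ge {d : ℕ} {m G H : EucProd d → ℂ} (hm : Integrable m)
    (hmG : Integrable (fun ξ => m ξ * G ξ)) (hmH : Integrable (fun ξ => m ξ * H ξ)) {D : ℝ}
    (hGH : ∀ ξ, ‖G ξ - H ξ‖ ≤ D) (x : EucProd d) {κ : ℝ}
    (hx : ∀ ξ, m ξ ≠ 0 → |eucDot x ξ| ≤ κ) :
    ((2 * Real.pi) ^ d)⁻¹ * (‖∫ ξ, m ξ * H ξ‖ - κ * (∫ ξ, ‖m ξ * H ξ‖) - (∫ ξ, ‖m ξ‖) * D) ≤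
      ‖invFourierT (fun ξ => m ξ * G ξ) x‖ := by
  have hc : Continuous (fun ξ : EucProd d => Complex.exp (Complex.I * (eucDot x ξ : ℂ))) := by
    unfold eucDot
    fun_prop
  have hn : ∀ ξ : EucProd d, ‖Complex.exp (Complex.I * (eucDot x ξ : ℂ))‖ = 1 := by
    intro ξ
    rw [Complex.norm_exp]
    simp
  have hi : ∀ {F : EucProd d → ℂ}, Integrable F →
      Integrable (fun ξ => Complex.exp (Complex.I * (eucDot x ξ : ℂ)) * F ξ) := fun hF =>
    hF.bdd_mul (c := 1) hc.aestronglyMeasurable (Eventually.of_forall fun ξ => (hn ξ).le)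
  rw [invFourierT, norm_mul, norm_inv, Complex.norm_real, Real.norm_of_nonneg (by positivity)]
  refine mul_le_mul_of_nonneg_left ?_ (by positivity)
  have h1 : ‖(∫ ξ, Complex.exp (Complex.I * (eucDot x ξ : ℂ)) * (m ξ * G ξ)) -
      ∫ ξ, Complex.exp (Complex.I * (eucDot x ξ : ℂ)) * (m ξ * H ξ)‖ ≤ (∫ ξ, ‖m ξ‖) * D := by
    rw [← integral_sub (hi hmG) (hi hmH), ← integral_mul_const]
    refine norm_integral_le_of_norm_le (hm.norm.mul_const D) (Eventually.of_forall fun ξ => ?_)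
    rw [← mul_sub, ← mul_sub, norm_mul, norm_mul, hn, one_mul]
    exact mul_le_mul_of_nonneg_left (hGH ξ) (norm_nonneg _)
  have h2 : ‖(∫ ξ, Complex.exp (Complex.I * (eucDot x ξ : ℂ)) * (m ξ * H ξ)) -
      ∫ ξ, m ξ * H ξ‖ ≤ κ * ∫ ξ, ‖m ξ * H ξ‖ := by
    rw [← integral_sub (hi hmH) hmH, ← integral_const_mul]
    refine norm_integral_le_of_norm_le (hmH.norm.const_mul κ) (Eventually.of_forall fun ξ => ?_)
    by_cases h0 : m ξ = 0
    · simp [h0]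
    · have h3 := Real.norm_exp_I_mul_ofReal_sub_one_le (x := eucDot x ξ)
      have h4 : Complex.exp (Complex.I * (eucDot x ξ : ℂ)) * (m ξ * H ξ) - m ξ * H ξ =
          (Complex.exp (Complex.I * (eucDot x ξ : ℂ)) - 1) * (m ξ * H ξ) := by ring
      rw [h4, norm_mul]
      exact mul_le_mul_of_nonneg_right (h3.trans (hx ξ h0)) (norm_nonneg _)
  have h5 := norm_sub_norm_le (∫ ξ, m ξ * H ξ)
    (∫ ξ, Complex.exp (Complex.I * (eucDot x ξ : ℂ)) * (m ξ * H ξ))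
  have h6 := norm_sub_norm_le (∫ ξ, Complex.exp (Complex.I * (eucDot x ξ : ℂ)) * (m ξ * H ξ))
    (∫ ξ, Complex.exp (Complex.I * (eucDot x ξ : ℂ)) * (m ξ * G ξ))
  rw [norm_sub_rev] at h5 h6
  linarith

/-- The focusing wave, and its Schwartz approximations, are amplified by the multiplier near the
origin. -/
theorem exists_schwartz_amplified {d k : ℕ} (hd : 2 ≤ d) (hk : 1 ≤ k) {ψ : ℝ → ℝ}
    (hψ : IsDyadicPartition ψ) {ε₀ : ℝ} (hε₀ : 0 < ε₀) (hε₀' : ε₀ ≤ 1 / 32) :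
    ∃ w : ℝ, 0 < w ∧ ∃ κ : ℝ, 0 < κ ∧ ∃ δ : ℝ, 0 < δ ∧ ∀ ε : ℝ, 0 < ε → ε ≤ δ →
      ∃ f : 𝓢(EucProd d, ℂ), f 0 ≠ 0 ∧ (∀ x, ‖f x‖ ≤ ‖focusingWave d ε x‖) ∧
        ∀ x : EucProd d, ‖x.1‖ ≤ κ → |x.2| ≤ κ / ε →
          w * ε ^ (-(((d : ℝ) - 2 + 2 * k) / 2)) ≤ ‖multiplierOp (mEps d k ψ ε₀ ε) f x‖ := by
  obtain ⟨w, hw, B, hB, δ, hδ, hbd⟩ := exists_bounds_mEps_mul_fourierT hd hk hψ hε₀ hε₀'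
  -- On the support `|x · ξ|` is at most four times `w / (16 B)`. The phase thus loses at most `w P
  -- / 4`, the Schwartz approximation as much again, and `w P / 2` survives.
  refine ⟨((2 * Real.pi) ^ d)⁻¹ * (w / 2), by positivity, w / (16 * B), by positivity, δ, hδ,
    fun ε hε hεδ => ?_⟩
  obtain ⟨hlow, hup⟩ := hbd ε hε hεδ
  set P := ε ^ (-(((d : ℝ) - 2 + 2 * k) / 2)) with hP
  have hP0 : 0 < P := Real.rpow_pos_of_pos hε _
  obtain ⟨f, hfle, hft, hf0⟩ := exists_schwartz_approx_focusingWave d hε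
  have hFi := integrable_focusingWave (d := d) hε
  have hm := integrable_mEps (d := d) (k := k) hψ hε₀ hε₀' hε
  set M := ∫ ξ, ‖mEps d k ψ ε₀ ε ξ‖ with hM
  have hM0 : 0 ≤ M := integral_nonneg fun ξ => norm_nonneg _
  have hconv : Tendsto (fun N => ∫ x, ‖f N x - focusingWave d ε x‖) atTop (𝓝 0) := by
    have := tendsto_integral_of_dominated_convergence (μ := (volume : Measure (EucProd d)))
      (F := fun N x => ‖f N x - focusingWave d ε x‖) (f := fun _ => (0 : ℝ))
      (fun x => 2 * ‖focusingWave d ε x‖)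
      (fun N => ((f N).continuous.sub (continuous_focusingWave d ε)).norm.aestronglyMeasurable)
      (hFi.norm.const_mul 2)
      (fun N => Eventually.of_forall fun x => by
        rw [norm_norm]
        have h1 := norm_sub_le (f N x) (focusingWave d ε x)
        have h2 := hfle N x
        linarith)
      (Eventually.of_forall fun x => by
        have := ((hft x).sub_const (focusingWave d ε x)).norm
        simpa using this)
    simpa using this
  -- The approximation may depend on `ε`, so it is harmless that `M` is not bounded uniformly in
  -- `ε`.
  have hev : ∀ᶠ N in atTop, ∫ x, ‖f N x - focusingWave d ε x‖ < w / 4 * P / (M + 1) :=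
    hconv.eventually (gt_mem_nhds (by positivity))
  obtain ⟨N, hN⟩ := hev.exists
  refine ⟨f N, hf0 N, hfle N, fun x hx1 hx2 => ?_⟩
  have hfi : Integrable (fun x => f N x) :=
    hFi.norm.mono' (f N).continuous.aestronglyMeasurable (Eventually.of_forall (hfle N))
  have hmG : Integrable (fun ξ => mEps d k ψ ε₀ ε ξ * fourierT (fun x => f N x) ξ) := by
    refine hm.mul_bdd (c := ∫ x, ‖f N x‖) (continuous_fourierT hfi).aestronglyMeasurable
      (Eventually.of_forall fun ξ => ?_)
    refine (norm_integral_le_integral_norm _).trans_eq ?_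
    congr 1
    ext x
    rw [norm_mul, Complex.norm_exp]
    simp
  have hge := norm_invFourierT_ge hm hmG (integrable_mEps_mul_fourierT (by omega) hψ hε₀ hε₀' hε)
    (norm_fourierT_sub_le hfi hFi) x (κ := 4 * (w / (16 * B))) (fun ξ hξ => by
      obtain ⟨h1, -, h3⟩ := mEps_support hψ hε₀ hε₀' hε hξ
      have h4 : ‖ξ.1‖ ≤ 2 := by
        have := (abs_le.1 h1).1
        nlinarith [norm_nonneg ξ.1]
      have h5 : |inner ℝ x.1 ξ.1| ≤ w / (16 * B) * 2 :=
        (abs_real_inner_le_norm _ _).trans (by gcongr)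
      have h6 : |x.2 * ξ.2| ≤ w / (16 * B) * 2 := by
        rw [abs_mul]
        calc |x.2| * |ξ.2| ≤ (w / (16 * B) / ε) * (2 * ε) := by gcongr
          _ = _ := by field_simp
      rw [eucDot]
      refine (abs_add_le _ _).trans ?_
      linarith)
  refine le_trans ?_ hge
  rw [mul_assoc]
  refine mul_le_mul_of_nonneg_left ?_ (by positivity)
  have h7 : 4 * (w / (16 * B)) * ∫ ξ, ‖mEps d k ψ ε₀ ε ξ * fourierT (focusingWave d ε) ξ‖ ≤
      w / 4 * P := by
    calc _ ≤ 4 * (w / (16 * B)) * (B * P) := by gcongr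
      _ = _ := by field_simp; norm_num
  have h8 : M * ∫ x, ‖f N x - focusingWave d ε x‖ ≤ w / 4 * P := by
    rw [lt_div_iff₀ (by positivity)] at hN
    have : 0 ≤ ∫ x, ‖f N x - focusingWave d ε x‖ := integral_nonneg fun x => norm_nonneg _
    nlinarith
  linarith

/-- The set where the output has size `ε^(-γ)` has measure of order `ε^(-1)` and gives `ε^(-γ -
1/q)`; dividing by the input norm `O(ε^(-d/p))` yields the exponent. -/
theorem le_pqNorm_mEps {d k : ℕ} (hd : 2 ≤ d) (hk : 1 ≤ k) {ψ : ℝ → ℝ}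
    (hψ : IsDyadicPartition ψ) {ε₀ : ℝ} (hε₀ : 0 < ε₀) (hε₀' : ε₀ ≤ 1 / 32) {p q : ℝ≥0∞}
    (hp : 1 ≤ p) (hq : 1 ≤ q) :
    ∃ c : ℝ, 0 < c ∧ ∃ δ : ℝ, 0 < δ ∧ ∀ ε : ℝ, 0 < ε → ε ≤ δ →
      ENNReal.ofReal (c * ε ^ lowerExponent d k p q) ≤
        pqNorm (multiplierOp (mEps d k ψ ε₀ ε)) p q := by
  obtain ⟨w, hw, κ, hκ, δ, hδ, hf⟩ := exists_schwartz_amplified hd hk hψ hε₀ hε₀'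
  obtain ⟨C, hC1, hC⟩ := exists_lintegral_focusingWave_le (d := d) (by omega)
  have hC0 : 0 < C := by linarith
  set U := volume.real (Metric.closedBall (0 : EuclideanSpace ℝ (Fin (d - 1))) κ) with hU
  have hUtop : volume (Metric.closedBall (0 : EuclideanSpace ℝ (Fin (d - 1))) κ) ≠ ⊤ :=
    (isCompact_closedBall _ _).measure_lt_top.ne
  have hU0 : 0 < U := ENNReal.toReal_pos (Metric.measure_closedBall_pos _ _ hκ).ne' hUtop
  set a := (p⁻¹).toReal with ha
  set b := (q⁻¹).toReal with hb
  set γ := ((d : ℝ) - 2 + 2 * k) / 2 with hγ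
  refine ⟨w * (U * (2 * κ)) ^ b / C ^ a, by positivity, δ, hδ, fun ε hε hεδ => ?_⟩
  obtain ⟨f, hf0, hfle, hfT⟩ := hf ε hε hεδ
  have hnorm : eLpNorm (fun x => f x) p volume ≤ ENNReal.ofReal (C ^ a * ε ^ (-(d * a))) := by
    refine (eLpNorm_le_lintegral_rpow hp fun x =>
      (hfle x).trans (norm_focusingWave_le_one hε x)).trans ?_
    have h1 : ∫⁻ x, ‖f x‖ₑ ≤ ENNReal.ofReal (C * ε ^ (-(d : ℝ))) := by
      refine le_trans (lintegral_mono fun x => ?_) (hC ε hε)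
      exact enorm_le_iff_norm_le.2 (hfle x)
    refine (ENNReal.rpow_le_rpow h1 ENNReal.toReal_nonneg).trans_eq ?_
    rw [ENNReal.ofReal_rpow_of_nonneg (by positivity) ENNReal.toReal_nonneg,
      Real.mul_rpow (by positivity) (by positivity), ← Real.rpow_mul hε.le, neg_mul]
  have hne : eLpNorm (fun x => f x) p volume ≠ 0 := by
    intro h
    rw [eLpNorm_eq_zero_iff f.continuous.aestronglyMeasurable (zero_lt_one.trans_le hp).ne'] at h
    have := (f.continuous.ae_eq_iff_eq volume continuous_const).1 h
    exact hf0 (congrFun this 0)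
  have hne' : eLpNorm (fun x => f x) p volume ≠ ⊤ := (hnorm.trans_lt ENNReal.ofReal_lt_top).ne
  set R : Set (EucProd d) := Metric.closedBall (0 : EuclideanSpace ℝ (Fin (d - 1))) κ ×ˢ
    Icc (-(κ / ε)) (κ / ε) with hR
  have hvol : volume R = ENNReal.ofReal (U * (2 * κ) * ε⁻¹) := by
    rw [hR, Measure.volume_eq_prod, Measure.prod_prod, Real.volume_Icc,
      ← ENNReal.ofReal_toReal hUtop, ← ENNReal.ofReal_mul ENNReal.toReal_nonneg]
    congr 1
    change U * _ = _
    ring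
  have hlow : ENNReal.ofReal (w * ε ^ (-γ) * (U * (2 * κ) * ε⁻¹) ^ b) ≤
      eLpNorm (multiplierOp (mEps d k ψ ε₀ ε) f) q volume := by
    have h1 := mul_rpow_le_eLpNorm (μ := volume) (f := multiplierOp (mEps d k ψ ε₀ ε) f) hq (s := R)
      (measurableSet_closedBall.prod measurableSet_Icc)
      (by rw [hvol]; simp only [ne_eq, ENNReal.ofReal_eq_zero, not_le]; positivity)
      (c := w * ε ^ (-γ)) (by positivity) (fun x hx => hfT x (mem_closedBall_zero_iff.1 hx.1)
        (abs_le.2 hx.2))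
    rw [hvol, ENNReal.ofReal_rpow_of_nonneg (by positivity) ENNReal.toReal_nonneg,
      ← ENNReal.ofReal_mul (by positivity)] at h1
    exact h1
  refine le_trans ?_ (le_pqNorm _ f hne hne')
  calc ENNReal.ofReal (w * (U * (2 * κ)) ^ b / C ^ a * ε ^ lowerExponent d k p q)
      = ENNReal.ofReal (w * ε ^ (-γ) * (U * (2 * κ) * ε⁻¹) ^ b) /
          ENNReal.ofReal (C ^ a * ε ^ (-(d * a))) := by
        rw [← ENNReal.ofReal_div_of_pos (by positivity)]
        congr 1
        have e1 : ε ^ lowerExponent d k p q = ε ^ (-γ) * ε ^ (-b) * ε ^ (d * a) := by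
          rw [← Real.rpow_add hε, ← Real.rpow_add hε, lowerExponent]
          congr 1
          ring
        have e2 : (U * (2 * κ) * ε⁻¹) ^ b = (U * (2 * κ)) ^ b * ε ^ (-b) := by
          rw [Real.mul_rpow (by positivity) (by positivity), Real.inv_rpow hε.le,
            ← Real.rpow_neg hε.le]
        rw [e1, e2, Real.rpow_neg hε.le (d * a)]
        field_simp
    _ ≤ _ := ENNReal.div_le_div hlow hnorm

/-! ### Sharpness along dyadic scales -/

/-- Comparing powers along the dyadic scales tending to zero. -/
theorem exponent_le_of_dyadic_bound {c C e s δ : ℝ} (hc : 0 < c) (hδ : 0 < δ)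
    (h : ∀ ν : ℤ, (2 : ℝ) ^ ν ≤ δ → c * ((2 : ℝ) ^ ν) ^ e ≤ C * ((2 : ℝ) ^ ν) ^ s) : s ≤ e := by
  by_contra! hlt
  have ht : Tendsto (fun j : ℕ => (1 / 2 : ℝ) ^ j) atTop (𝓝 0) :=
    tendsto_pow_atTop_nhds_zero_of_lt_one (by norm_num) (by norm_num)
  have ht2 : Tendsto (fun j : ℕ => C * ((1 / 2 : ℝ) ^ j) ^ (s - e)) atTop (𝓝 0) := by
    have h1 := ((Real.continuousAt_rpow_const 0 (s - e) (Or.inr (by linarith))).tendsto.comp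
      ht).const_mul C
    rw [Real.zero_rpow (by linarith), mul_zero] at h1
    exact h1
  obtain ⟨j, hj1, hj2⟩ := ((ht.eventually (gt_mem_nhds hδ)).and
    (ht2.eventually (gt_mem_nhds hc))).exists
  have e1 : (2 : ℝ) ^ (-(j : ℤ)) = (1 / 2 : ℝ) ^ j := by
    rw [zpow_neg, zpow_natCast, one_div, inv_pow]
  have h1 := h (-(j : ℤ)) (by rw [e1]; exact hj1.le)
  rw [e1] at h1
  have hpos : (0 : ℝ) < (1 / 2 : ℝ) ^ j := by positivity
  have h2 : ((1 / 2 : ℝ) ^ j) ^ s = ((1 / 2 : ℝ) ^ j) ^ (s - e) * ((1 / 2 : ℝ) ^ j) ^ e := by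
    rw [← Real.rpow_add hpos]
    ring_nf
  rw [h2, ← mul_assoc] at h1
  have h3 := le_of_mul_le_mul_right h1 (Real.rpow_pos_of_pos hpos e)
  linarith

end DyadicMultiplier

theorem proposition3p7 (d k : ℕ) (hd : 2 ≤ d) (hk : 1 ≤ k)
    (ψ : ℝ → ℝ) (hψ : IsDyadicPartition ψ)
    (ε₀ : ℝ) (hε₀ : 0 < ε₀) (hε₀' : ε₀ ≤ (2 : ℝ) ^ (-5 : ℤ))
    (p q : ℝ≥0∞) (hp : 1 ≤ p) (hq : 1 ≤ q) :
    (∃ c : ℝ, 0 < c ∧ ∃ δ : ℝ, 0 < δ ∧ ∀ ε : ℝ, 0 < ε → ε ≤ δ →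
      ENNReal.ofReal (c * ε ^ lowerExponent d k p q) ≤
        pqNorm (multiplierOp (mEps d k ψ ε₀ ε)) p q) ∧
    (∀ s C : ℝ,
      (∀ ν : ℤ, (2 : ℝ) ^ ν ≤ ε₀ →
        pqNorm (multiplierOp (mEps d k ψ ε₀ ((2 : ℝ) ^ ν))) p q ≤
          ENNReal.ofReal (C * ((2 : ℝ) ^ ν) ^ s)) →
      s ≤ lowerExponent d k p q) := by
  have hε₀'' : ε₀ ≤ 1 / 32 := hε₀'.trans_eq (by norm_num)
  have hmain := DyadicMultiplier.le_pqNorm_mEps hd hk hψ hε₀ hε₀'' hp hq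
  refine ⟨hmain, fun s C hsC => ?_⟩
  obtain ⟨c, hc, δ, hδ, hlow⟩ := hmain
  refine DyadicMultiplier.exponent_le_of_dyadic_bound (C := C) hc (lt_min hδ hε₀) fun ν hν => ?_
  have hν0 : (0 : ℝ) < (2 : ℝ) ^ ν := by positivity
  have h1 := (hlow _ hν0 (hν.trans (min_le_left _ _))).trans (hsC ν (hν.trans (min_le_right _ _)))
  have hpos : 0 < c * ((2 : ℝ) ^ ν) ^ lowerExponent d k p q :=
    mul_pos hc (Real.rpow_pos_of_pos hν0 _)
  -- `ENNReal.ofReal` sends negative numbers to `0`, and `C` may be negative; the alternative that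
  -- the left side is nonpositive contradicts `hpos`.
  rcases ENNReal.ofReal_le_ofReal_iff'.1 h1 with h | h
  · exact h
  · linarith
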